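/- Let $(\zeta_j)_{j\in\mathbb Z}$ be i.i.d. positive random variables with finite mean $\mu$. Define the environment $\omega=(\omega_k)_{k\in\mathbb Z}$ by $\omega_0=0$ and $\omega_k=\omega_{k-1}+\zeta_k$ for all $k\in\mathbb Z$, and let $P$ be its law on the set $\Omega$ of strictly increasing sequences $\omega:\mathbb Z\to\mathbb R$ with $\omega_0=0$ (with the $\sigma$-algebra generated by the coordinates). Let $(p_k)_{k\in\mathbb Z}$ be a probability density on $\mathbb Z$ with $p_{-k}=p_k$ for all $k$, $p_{k+1}\le p_k$ for all $k\ge 0$, and $\sum_k k^2p_k\in(0,\infty)$. Let $\xi_1,\xi_2,\dots$ be i.i.d. with density $(p_k)$, let $S_0=0$, $S_n=\xi_1+\dots+\xi_n$, and let $Q$ be the law of $S=(S_n)_{n\ge 0}$ on $\mathbb Z^{\mathbb N}$. Put $$\bar m=\sum_{k\in\mathbb Z}|k|\,p_k,\qquad m_2=\lim_{n\to\infty}\frac{E_Q(|S_n|^2)}{n}.$$ For given $S$ and $\omega$ let $\tau(0)=0$, $\tau(n)=\sum_{k=1}^n|\omega_{S_k}-\omega_{S_{k-1}}|$, and define $$X(t)=\omega_{S_n}+\operatorname{sgn}(\xi_{n+1})\,(t-\tau(n))\quad\text{for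 } t\in[\tau(n),\tau(n+1)).$$ For every $\omega\in\Omega$ this defines, for $Q$-a.e. $S$, a continuous path on $[0,\infty)$. Let $P_\omega$ be the law of $X$ under $Q$, for fixed $\omega$, on the space $\mathcal C=C([0,\infty);\mathbb R)$ with the Borel $\sigma$-algebra of the Skorokhod topology (which on $\mathcal C$ is that of locally uniform convergence), and let $\mathbb P$ be the annealed law, i.e. the probability measure on $\mathcal C\times\Omega$ with $$\mathbb P(G\times F)=\int_F P_\omega(G)\,P(d\omega)$$ for all measurable $G\subseteq\mathcal C$ and $F\subseteq\Omega$. Then the limit defining $m_2$ exists, and under $\mathbb P$ $$\frac{X(t)}{\sqrt t}\ \longrightarrow\ \mathcal N\!\left(0,\frac{\mu}{\bar m}\,m_2\right)\quad\text{in distribution as } t\to\infty,$$ where $\mathcal N(0,\sigma^2)$ is the centered normal distribution with variance $\sigma^2$. -/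

import Mathlib

open MeasureTheory ProbabilityTheory Filter Topology
open scoped NNReal

noncomputable section

namespace LevyWalk

/-! The environment -/

/-- An environment: a strictly increasing bi-infinite array `ω` of targets with `ω 0 = 0`. -/
def Env : Type := {ω : ℤ → ℝ // ω 0 = 0 ∧ StrictMono ω}

instance : CoeFun Env (fun _ => ℤ → ℝ) := ⟨Subtype.val⟩

/-- The sigma-algebra generated by the coordinates. -/
instance : MeasurableSpace Env :=
  inferInstanceAs (MeasurableSpace {ω : ℤ → ℝ // ω 0 = 0 ∧ StrictMono ω})

/-- The `k`-th target: `ζ 1 + ⋯ + ζ k` for `0 ≤ k` and `-(ζ (k+1) + ⋯ + ζ 0)` for `k < 0`. -/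
def target (ζ : ℤ → Set.Ioi (0 : ℝ)) (k : ℤ) : ℝ :=
  ∑ i ∈ Finset.Ioc 0 k, (ζ i : ℝ) - ∑ i ∈ Finset.Ioc k 0, (ζ i : ℝ)

theorem target_zero (ζ : ℤ → Set.Ioi (0 : ℝ)) : target ζ 0 = 0 := by simp [target]

theorem target_eq_add (ζ : ℤ → Set.Ioi (0 : ℝ)) (k : ℤ) :
    target ζ k = target ζ (k - 1) + ζ k := by
  unfold target
  rcases le_or_gt k 0 with hk | hk
  · have h1 : Finset.Ioc 0 k = ∅ := Finset.Ioc_eq_empty (by omega)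
    have h2 : Finset.Ioc 0 (k - 1) = ∅ := Finset.Ioc_eq_empty (by omega)
    have h3 : Finset.Ioc (k - 1) 0 = insert k (Finset.Ioc k 0) := by
      ext i; simp only [Finset.mem_Ioc, Finset.mem_insert]; omega
    rw [h1, h2, h3, Finset.sum_insert (by simp)]; simp
  · have h1 : Finset.Ioc k 0 = ∅ := Finset.Ioc_eq_empty (by omega)
    have h2 : Finset.Ioc (k - 1) 0 = ∅ := Finset.Ioc_eq_empty (by omega)
    have h3 : Finset.Ioc 0 k = insert k (Finset.Ioc 0 (k - 1)) := by
      ext i; simp only [Finset.mem_Ioc, Finset.mem_insert]; omega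
    rw [h1, h2, h3, Finset.sum_insert (by simp)]; simp [add_comm]

theorem target_strictMono (ζ : ℤ → Set.Ioi (0 : ℝ)) : StrictMono (target ζ) := by
  refine strictMono_int_of_lt_succ fun k => ?_
  have h := target_eq_add ζ (k + 1)
  have h' : (0 : ℝ) < ζ (k + 1) := (ζ (k + 1)).2
  rw [add_sub_cancel_right] at h
  linarith

/-- The environment with gaps `ζ`: `ω 0 = 0` and `ω k = ω (k - 1) + ζ k` for all `k`. -/
def envOfGaps (ζ : ℤ → Set.Ioi (0 : ℝ)) : Env :=
  ⟨target ζ, target_zero ζ, target_strictMono ζ⟩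

theorem measurable_envOfGaps : Measurable envOfGaps := by
  refine Measurable.subtype_mk (measurable_pi_lambda _ fun k => ?_)
  unfold target
  fun_prop

/-- The law of the environment when the gaps are i.i.d. with law `ν` on `(0, ∞)`. -/
def envLaw (ν : Measure (Set.Ioi (0 : ℝ))) [IsProbabilityMeasure ν] : Measure Env :=
  (Measure.infinitePi fun _ : ℤ => ν).map envOfGaps

instance (ν : Measure (Set.Ioi (0 : ℝ))) [IsProbabilityMeasure ν] :
    IsProbabilityMeasure (envLaw ν) :=
  Measure.isProbabilityMeasure_map measurable_envOfGaps.aemeasurable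

/-- The mean gap. -/
def meanGap (ν : Measure (Set.Ioi (0 : ℝ))) : ℝ := ∫ z, (z : ℝ) ∂ν

/-! The underlying random walk -/

/-- `S 0 = 0` and `S n = ξ_1 + ⋯ + ξ_n`; the increment `ξ_{i+1}` is stored as `ξ i`. -/
def walkOfIncrements (ξ : ℕ → ℤ) (n : ℕ) : ℤ := ∑ i ∈ Finset.range n, ξ i

theorem measurable_walkOfIncrements : Measurable walkOfIncrements := by
  refine measurable_pi_lambda _ fun n => ?_
  unfold walkOfIncrements
  fun_prop

/-- The law on `ℤ^ℕ` of the walk started at `0` with i.i.d. increments of density `p`. -/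
def walkLaw (p : PMF ℤ) : Measure (ℕ → ℤ) :=
  (Measure.infinitePi fun _ : ℕ => p.toMeasure).map walkOfIncrements

instance (p : PMF ℤ) : IsProbabilityMeasure (walkLaw p) :=
  Measure.isProbabilityMeasure_map measurable_walkOfIncrements.aemeasurable

/-- The mean absolute jump `∑ |k| p_k`. -/
def meanAbsJump (p : PMF ℤ) : ℝ := ∑' k : ℤ, |(k : ℝ)| * (p k).toReal

/-- `E(|S_n|^q) / n^(q/2)`. -/
def normalizedMoment (p : PMF ℤ) (q : ℝ) (n : ℕ) : ℝ :=
  (∫ S, |(S n : ℝ)| ^ q ∂(walkLaw p)) / (n : ℝ) ^ (q / 2)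

/-- The limit `m_q` of `E(|S_n|^q) / n^(q/2)` as `n → ∞`. -/
def rescaledMoment (p : PMF ℤ) (q : ℝ) : ℝ := limUnder atTop (normalizedMoment p q)

/-! The continuous-time process -/

/-- The collision times: total length of the first `n` jumps of `n ↦ ω (S n)`. -/
def collisionTime (S : ℕ → ℤ) (ω : Env) (n : ℕ) : ℝ :=
  ∑ k ∈ Finset.range n, |ω (S (k + 1)) - ω (S k)|

/-- The index `n` such that `τ n ≤ t < τ (n + 1)`. -/
def collisionIndex (S : ℕ → ℤ) (ω : Env) (t : ℝ) : ℕ :=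
  sInf {n : ℕ | collisionTime S ω n ≤ t ∧ t < collisionTime S ω (n + 1)}

/-- `X(t) = ω_{S_n} + sgn(ξ_{n+1}) (t - τ(n))` for `t ∈ [τ(n), τ(n+1))`. -/
def position (S : ℕ → ℤ) (ω : Env) (t : ℝ) : ℝ :=
  ω (S (collisionIndex S ω t)) +
    ((S (collisionIndex S ω t + 1) - S (collisionIndex S ω t)).sign : ℝ) *
      (t - collisionTime S ω (collisionIndex S ω t))

theorem collisionTime_mono (S : ℕ → ℤ) (ω : Env) : Monotone (collisionTime S ω) := by
  refine monotone_nat_of_le_succ fun n => ?_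
  simp only [collisionTime, Finset.sum_range_succ]
  linarith [abs_nonneg (ω (S (n + 1)) - ω (S n))]

theorem collisionIndex_eq {S : ℕ → ℤ} {ω : Env} {t : ℝ} {n : ℕ}
    (h1 : collisionTime S ω n ≤ t) (h2 : t < collisionTime S ω (n + 1)) :
    collisionIndex S ω t = n := by
  have hset : {m : ℕ | collisionTime S ω m ≤ t ∧ t < collisionTime S ω (m + 1)} = {n} := by
    ext m
    simp only [Set.mem_ofPred_eq, Set.mem_singleton_iff]
    refine ⟨fun ⟨h3, h4⟩ => ?_, fun h => h ▸ ⟨h1, h2⟩⟩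
    rcases lt_trichotomy m n with h | h | h
    · linarith [collisionTime_mono S ω (show m + 1 ≤ n by omega)]
    · exact h
    · linarith [collisionTime_mono S ω (show n + 1 ≤ m by omega)]
  rw [collisionIndex, hset, csInf_singleton]

theorem position_eq {S : ℕ → ℤ} {ω : Env} {t : ℝ} {n : ℕ}
    (h1 : collisionTime S ω n ≤ t) (h2 : t < collisionTime S ω (n + 1)) :
    position S ω t = ω (S n) + ((S (n + 1) - S n).sign : ℝ) * (t - collisionTime S ω n) := by
  rw [position, collisionIndex_eq h1 h2]

theorem target_succ_eq (S : ℕ → ℤ) (ω : Env) (n : ℕ) :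
    ω (S (n + 1)) = ω (S n) +
      ((S (n + 1) - S n).sign : ℝ) * (collisionTime S ω (n + 1) - collisionTime S ω n) := by
  have h : collisionTime S ω (n + 1) - collisionTime S ω n = |ω (S (n + 1)) - ω (S n)| := by
    simp [collisionTime, Finset.sum_range_succ]
  rw [h]
  rcases lt_trichotomy (S n) (S (n + 1)) with h | h | h
  · rw [Int.sign_eq_one_of_pos (by omega), abs_of_pos (sub_pos.2 (ω.2.2 h))]; simp
  · simp [h]
  · rw [Int.sign_eq_neg_one_of_neg (by omega), abs_of_neg (sub_neg.2 (ω.2.2 h))]; simp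

theorem exists_index {S : ℕ → ℤ} {ω : Env} {t : ℝ} (ht : 0 ≤ t)
    (h : ∃ n, t < collisionTime S ω n) :
    ∃ n, collisionTime S ω n ≤ t ∧ t < collisionTime S ω (n + 1) := by
  classical
  have hpos : Nat.find h ≠ 0 := by
    intro h0
    have := Nat.find_spec h
    rw [h0] at this
    simp [collisionTime] at this
    linarith
  refine ⟨Nat.find h - 1, not_lt.1 (Nat.find_min h (by omega)), ?_⟩
  rw [Nat.sub_add_cancel (by omega)]
  exact Nat.find_spec h

/-- The affine formula of a piece also holds at its right end. -/
theorem position_eq_closed {S : ℕ → ℤ} {ω : Env} (h : ∀ t : ℝ, ∃ n, t < collisionTime S ω n)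
    {t : ℝ} (n : ℕ) (h1 : collisionTime S ω n ≤ t) (h2 : t ≤ collisionTime S ω (n + 1)) :
    position S ω t = ω (S n) + ((S (n + 1) - S n).sign : ℝ) * (t - collisionTime S ω n) := by
  have h0 : 0 ≤ t := le_trans (by
    have := collisionTime_mono S ω (Nat.zero_le n)
    simpa [collisionTime] using this) h1
  obtain ⟨m, hm1, hm2⟩ := exists_index h0 (h t)
  -- between the ends of piece `n` and the start of piece `m` the walk does not move
  have key : ∀ j, n ≤ j → j ≤ m → ω (S j) + ((S (j + 1) - S j).sign : ℝ) *
      (t - collisionTime S ω j) = ω (S n) + ((S (n + 1) - S n).sign : ℝ) *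
      (t - collisionTime S ω n) := by
    intro j hj
    induction j, hj using Nat.le_induction with
    | base => intro _; rfl
    | succ j hj ih =>
      intro hjm
      rw [← ih (by omega)]
      have h3 : collisionTime S ω (j + 1) = t :=
        le_antisymm ((collisionTime_mono S ω hjm).trans hm1)
          (h2.trans (collisionTime_mono S ω (by omega)))
      rw [target_succ_eq S ω j, h3]; simp
  rcases le_or_gt n m with hnm | hnm
  · rw [position_eq hm1 hm2, key m hnm le_rfl]
  · linarith [collisionTime_mono S ω (show m + 1 ≤ n by omega)]

theorem continuous_position {S : ℕ → ℤ} {ω : Env}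
    (h : ∀ t : ℝ, ∃ n, t < collisionTime S ω n) :
    Continuous fun t : ℝ≥0 => position S ω t := by
  refine LocallyFinite.continuous (f := fun n : ℕ => {t : ℝ≥0 |
    collisionTime S ω n ≤ t ∧ (t : ℝ) ≤ collisionTime S ω (n + 1)}) ?_ ?_ ?_ ?_
  · intro t
    obtain ⟨N, hN⟩ := h t
    refine ⟨{s : ℝ≥0 | (s : ℝ) < collisionTime S ω N},
      (isOpen_lt NNReal.continuous_coe continuous_const).mem_nhds hN, ?_⟩
    refine (Set.finite_lt_nat N).subset ?_
    rintro n ⟨s, ⟨hs1, _⟩, hs2⟩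
    simp only [Set.mem_ofPred_eq] at hs2 ⊢
    by_contra hn
    linarith [collisionTime_mono S ω (not_lt.1 hn)]
  · refine Set.eq_univ_of_forall fun t => Set.mem_iUnion.2 ?_
    obtain ⟨n, h1, h2⟩ := exists_index t.2 (h t)
    exact ⟨n, h1, h2.le⟩
  · intro n
    exact (isClosed_le continuous_const NNReal.continuous_coe).inter
      (isClosed_le NNReal.continuous_coe continuous_const)
  · intro n
    refine ContinuousOn.congr (f := fun t : ℝ≥0 => ω (S n) +
      ((S (n + 1) - S n).sign : ℝ) * ((t : ℝ) - collisionTime S ω n)) (by fun_prop) ?_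
    intro t ht
    exact position_eq_closed h n ht.1 ht.2

/-- The space of continuous paths from `[0, ∞)` to `ℝ`; on it the Skorokhod topology is
the topology of locally uniform convergence, which is the one that `C(ℝ≥0, ℝ)` carries. -/
abbrev PathSpace : Type := C(ℝ≥0, ℝ)

instance : MeasurableSpace PathSpace := borel _
instance : BorelSpace PathSpace := ⟨rfl⟩

/-- A map into the path space is measurable as soon as its coordinates are. -/
theorem measurable_of_eval {α : Type*} [MeasurableSpace α] {f : α → PathSpace}
    (hf : ∀ t, Measurable fun a => f a t) : Measurable f := by
  have hb : (borel PathSpace) = MeasurableSpace.generateFrom _ :=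
    borel_eq_generateFrom_of_subbasis ContinuousMap.compactOpen_eq
  rw [BorelSpace.measurable_eq (α := PathSpace), hb]
  refine measurable_generateFrom ?_
  rintro _ ⟨K, hK, U, hU, rfl⟩
  replace hU : IsOpen U := hU
  obtain ⟨D, hDK, hDc, hD⟩ := TopologicalSpace.IsSeparable.exists_countable_dense_subset
    (hK.isSeparable)
  have hset : f ⁻¹' {g : PathSpace | Set.MapsTo g K U} =
      ⋃ n : ℕ, ⋂ t ∈ D, {a | ((n : ENNReal) + 1)⁻¹ ≤ Metric.infEDist (f a t) Uᶜ} := by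
    ext a
    simp only [Set.mem_preimage, Set.mem_ofPred_eq, Set.mem_iUnion, Set.mem_iInter]
    constructor
    · intro h
      rcases K.eq_empty_or_nonempty with rfl | hne
      · exact ⟨0, fun t ht => absurd (hDK ht) (Set.notMem_empty t)⟩
      obtain ⟨t₀, ht₀, hmin⟩ := hK.exists_isMinOn hne
        ((Metric.continuous_infEDist (s := Uᶜ)).comp (f a).continuous).continuousOn
      have hne0 : Metric.infEDist (f a t₀) Uᶜ ≠ 0 := fun h0 =>
        (Metric.mem_iff_infEDist_zero_of_closed hU.isClosed_compl).2 h0 (h ht₀)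
      obtain ⟨n, hn⟩ := ENNReal.exists_inv_nat_lt hne0
      refine ⟨n, fun t ht => ?_⟩
      exact (ENNReal.inv_le_inv.2 le_self_add).trans (hn.le.trans (hmin (hDK ht)))
    · rintro ⟨n, hn⟩ t ht
      have hcl : IsClosed {t | ((n : ENNReal) + 1)⁻¹ ≤ Metric.infEDist (f a t) Uᶜ} :=
        isClosed_le continuous_const (Metric.continuous_infEDist.comp (f a).continuous)
      have hle : ((n : ENNReal) + 1)⁻¹ ≤ Metric.infEDist (f a t) Uᶜ :=
        closure_minimal (fun t ht => hn t ht) hcl (hD ht)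
      by_contra hU'
      have hz : Metric.infEDist (f a t) Uᶜ = 0 := Metric.infEDist_zero_of_mem hU'
      rw [hz] at hle
      simp at hle
  rw [hset]
  refine MeasurableSet.iUnion fun n => MeasurableSet.biInter hDc fun t _ => ?_
  exact measurableSet_le measurable_const (measurable_infEDist.comp (hf t))

open Classical in
/-- The trajectory `t ↦ X(t)` as a continuous path. The collision times are unbounded for
almost every `S`, whatever `ω`; on the remaining null set the path is set to `0`. -/
def path (S : ℕ → ℤ) (ω : Env) : PathSpace :=
  if h : ∀ t : ℝ, ∃ n, t < collisionTime S ω n then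
    ⟨fun t : ℝ≥0 => position S ω t, continuous_position h⟩
  else 0

theorem measurable_envEval {f : (ℕ → ℤ) × Env → ℤ} (hf : Measurable f) :
    Measurable fun x : (ℕ → ℤ) × Env => x.2 (f x) := by
  have h : Measurable fun y : ((ℕ → ℤ) × Env) × ℤ => y.1.2 y.2 :=
    measurable_from_prod_countable_left fun k =>
      (measurable_pi_apply k).comp (measurable_subtype_coe.comp measurable_snd)
  exact h.comp (measurable_id.prodMk hf)

theorem measurable_walkEval (n : ℕ) : Measurable fun x : (ℕ → ℤ) × Env => x.1 n :=
  (measurable_pi_apply n).comp measurable_fst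

theorem measurable_collisionTime (n : ℕ) :
    Measurable fun x : (ℕ → ℤ) × Env => collisionTime x.1 x.2 n := by
  unfold collisionTime
  refine Finset.measurable_sum _ fun k _ => ?_
  exact ((measurable_envEval (measurable_walkEval (k + 1))).sub
    (measurable_envEval (measurable_walkEval k))).abs

theorem measurable_collisionIndex (t : ℝ) :
    Measurable fun x : (ℕ → ℤ) × Env => collisionIndex x.1 x.2 t := by
  have hA : ∀ n, MeasurableSet {x : (ℕ → ℤ) × Env |
      collisionTime x.1 x.2 n ≤ t ∧ t < collisionTime x.1 x.2 (n + 1)} := fun n =>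
    (measurableSet_le (measurable_collisionTime n) measurable_const).inter
      (measurableSet_lt measurable_const (measurable_collisionTime (n + 1)))
  refine measurable_to_countable' fun n => ?_
  have hset : (fun x : (ℕ → ℤ) × Env => collisionIndex x.1 x.2 t) ⁻¹' {n} =
      {x | collisionTime x.1 x.2 n ≤ t ∧ t < collisionTime x.1 x.2 (n + 1)} ∪
      ((⋂ m, {x : (ℕ → ℤ) × Env |
        collisionTime x.1 x.2 m ≤ t ∧ t < collisionTime x.1 x.2 (m + 1)}ᶜ) ∩ {_x | n = 0}) := by
    ext x
    simp only [Set.mem_preimage, Set.mem_singleton_iff, Set.mem_union, Set.mem_inter_iff,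
      Set.mem_iInter, Set.mem_compl_iff, Set.mem_ofPred_eq]
    constructor
    · intro hx
      by_cases hex : ∃ m, collisionTime x.1 x.2 m ≤ t ∧ t < collisionTime x.1 x.2 (m + 1)
      · obtain ⟨m, hm⟩ := hex
        rw [collisionIndex_eq hm.1 hm.2] at hx
        exact Or.inl (hx ▸ hm)
      · refine Or.inr ⟨fun m hm => hex ⟨m, hm⟩, ?_⟩
        rw [← hx, collisionIndex, Nat.sInf_eq_zero]
        exact Or.inr (Set.eq_empty_of_forall_notMem fun m hm => hex ⟨m, hm⟩)
    · rintro (hx | ⟨hx, rfl⟩)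
      · exact collisionIndex_eq hx.1 hx.2
      · rw [collisionIndex, Nat.sInf_eq_zero]
        exact Or.inr (Set.eq_empty_of_forall_notMem fun m hm => hx m hm)
  rw [hset]
  exact (hA n).union ((MeasurableSet.iInter fun m => (hA m).compl).inter (MeasurableSet.const _))

theorem measurable_position (t : ℝ) :
    Measurable fun x : (ℕ → ℤ) × Env => position x.1 x.2 t := by
  have h : Measurable fun y : ((ℕ → ℤ) × Env) × ℕ => y.1.2 (y.1.1 y.2) +
      ((y.1.1 (y.2 + 1) - y.1.1 y.2).sign : ℝ) * (t - collisionTime y.1.1 y.1.2 y.2) := by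
    refine measurable_from_prod_countable_left fun n => ?_
    have hs : Measurable fun k : ℤ => ((k.sign : ℤ) : ℝ) := measurable_from_top
    exact (measurable_envEval (measurable_walkEval n)).add
      ((hs.comp ((measurable_walkEval (n + 1)).sub (measurable_walkEval n))).mul
        (measurable_const.sub (measurable_collisionTime n)))
  exact h.comp (measurable_id.prodMk (measurable_collisionIndex t))

theorem measurable_path : Measurable fun x : (ℕ → ℤ) × Env => path x.1 x.2 := by
  classical
  refine measurable_of_eval fun t => ?_
  have hset : MeasurableSet {x : (ℕ → ℤ) × Env | ∀ s : ℝ, ∃ n, s < collisionTime x.1 x.2 n} := by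
    have heq : {x : (ℕ → ℤ) × Env | ∀ s : ℝ, ∃ n, s < collisionTime x.1 x.2 n} =
        ⋂ N : ℕ, ⋃ n : ℕ, {x | (N : ℝ) < collisionTime x.1 x.2 n} := by
      ext x
      simp only [Set.mem_iInter, Set.mem_iUnion, Set.mem_ofPred_eq]
      refine ⟨fun h N => h N, fun h s => ?_⟩
      obtain ⟨N, hN⟩ := exists_nat_gt s
      obtain ⟨n, hn⟩ := h N
      exact ⟨n, hN.trans hn⟩
    rw [heq]
    exact MeasurableSet.iInter fun N => MeasurableSet.iUnion fun n =>
      measurableSet_lt measurable_const (measurable_collisionTime n)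
  have heval : (fun x : (ℕ → ℤ) × Env => path x.1 x.2 t) = fun x =>
      if ∀ s : ℝ, ∃ n, s < collisionTime x.1 x.2 n then position x.1 x.2 t else 0 := by
    funext x
    unfold path
    split_ifs <;> rfl
  rw [heval]
  exact Measurable.ite hset (measurable_position t) measurable_const

/-- The quenched law: the law of `X` on the path space for a fixed environment, as a
measurable function of the environment. -/
def quenchedLaw (p : PMF ℤ) : Kernel Env PathSpace where
  toFun ω := (walkLaw p).map fun S => path S ω
  measurable' := by
    have h : ∀ ω : Env, (walkLaw p).map (fun S => path S ω) =
        ((walkLaw p).map fun S => (S, ω)).map fun x => path x.1 x.2 := fun ω => by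
      rw [Measure.map_map measurable_path measurable_prodMk_right]; rfl
    simp_rw [h]
    exact (Measure.measurable_map _ measurable_path).comp Measurable.map_prodMk_right

instance (p : PMF ℤ) : IsMarkovKernel (quenchedLaw p) where
  isProbabilityMeasure _ := Measure.isProbabilityMeasure_map
    (measurable_path.comp (measurable_id.prodMk measurable_const)).aemeasurable

/-- The annealed law on `PathSpace × Env`; see `annealedLaw_prod`. -/
def annealedLaw (ν : Measure (Set.Ioi (0 : ℝ))) [IsProbabilityMeasure ν] (p : PMF ℤ) :
    Measure (PathSpace × Env) :=
  ((envLaw ν) ⊗ₘ (quenchedLaw p)).map Prod.swap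

instance (ν : Measure (Set.Ioi (0 : ℝ))) [IsProbabilityMeasure ν] (p : PMF ℤ) :
    IsProbabilityMeasure (annealedLaw ν p) :=
  Measure.isProbabilityMeasure_map measurable_swap.aemeasurable

/-- The defining formula of the annealed law. -/
theorem annealedLaw_prod (ν : Measure (Set.Ioi (0 : ℝ))) [IsProbabilityMeasure ν] (p : PMF ℤ)
    {G : Set PathSpace} {F : Set Env} (hG : MeasurableSet G) (hF : MeasurableSet F) :
    annealedLaw ν p (G ×ˢ F) = ∫⁻ ω in F, quenchedLaw p ω G ∂(envLaw ν) := by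
  rw [annealedLaw, Measure.map_apply measurable_swap (hG.prod hF), Set.preimage_swap_prod,
    Measure.compProd_apply_prod hF hG]

end LevyWalk

end

/-! Write `μ` for the mean gap, `J` for the mean absolute jump, `v` for the variance of a jump. The
claim is that, in probability, `X(t) = μ S_N + o(√t)` with the deterministic index `N = ⌊t / (μ
J)⌋`. The central limit theorem for `S` then gives the limit variance `μ² v / (μ J) = (μ / J) v`,
and `v` is `m₂` by additivity of variance.

Two facts give the approximation. The first is `τ(n) / n → μ J` in probability. For fixed `S`,
`τ(n)` is a sum of gaps weighted by edge crossing numbers. The weights add up to the total jump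
length, about `n J`, and the sum of their squares is the total overlap of pairs of jumps. Two jumps
that are not long overlap only if the walk comes back within a bounded distance, which has vanishing
probability after many steps; so the mean total overlap is `o(n²)`
(`eventually_integral_sum_card_inter_le`). A weak law for weighted sums that asks only for a first
moment (`exists_integral_abs_weighted_le`) then yields `tendsto_measure_collisionTime`.

The second is that nothing moves much near time `N`. With high probability the jump under way at
time `t` has index between `(1 - ε) t / (μ J)` and `(1 + ε) t / (μ J)`. By Kolmogorov's inequality
the walk stays within `δ √t` of its value at the start of this window, so monotonicity of the
environment traps `X(t)` between the targets at `S_N ± 2c`, where `c = ⌊δ √t⌋`. These labels are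
independent of the gaps, and the law of large numbers for the environment
(`exists_measure_target_walk_le`) replaces the targets by `μ (S_N ± 2c)`. -/

namespace LevyWalk

/-! ### Sums of i.i.d. coordinates: weak law with weights, maximal inequality -/

section Product

variable {ι α : Type*} {mα : MeasurableSpace α} {κ : Measure α} [IsProbabilityMeasure κ]

theorem memLp_eval {f : α → ℝ} {q : ENNReal} (hf : MemLp f q κ) (i : ι) :
    MemLp (fun x : ι → α => f (x i)) q (Measure.infinitePi fun _ : ι => κ) :=
  hf.comp_measurePreserving (measurePreserving_eval_infinitePi (fun _ : ι => κ) i)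

theorem identDistrib_eval {f : α → ℝ} (hf : Measurable f) (i : ι) :
    IdentDistrib (fun x : ι → α => f (x i)) f (Measure.infinitePi fun _ : ι => κ) κ where
  aemeasurable_fst := (hf.comp (measurable_pi_apply i)).aemeasurable
  aemeasurable_snd := by fun_prop
  map_eq := by
    have h := (measurePreserving_eval_infinitePi (fun _ : ι => κ) i).map_eq
    conv_rhs => rw [← h]
    rw [Measure.map_map hf (by fun_prop)]
    rfl

theorem variance_weighted_sum {f : α → ℝ} (hf : Measurable f) (hf2 : MemLp f 2 κ)
    (s : Finset ι) (w : ι → ℝ) :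
    Var[fun x : ι → α => ∑ i ∈ s, w i * f (x i); Measure.infinitePi fun _ : ι => κ] =
      (∑ i ∈ s, w i ^ 2) * Var[f; κ] := by
  have hind : iIndepFun (fun i (x : ι → α) => w i * f (x i)) (Measure.infinitePi fun _ : ι => κ) :=
    iIndepFun_infinitePi (X := fun i a => w i * f a) fun i => by fun_prop
  have h := IndepFun.variance_sum (s := s) (X := fun i (x : ι → α) => w i * f (x i))
    (μ := Measure.infinitePi fun _ : ι => κ)
    (fun i _ => (memLp_eval hf2 i).const_mul (w i)) fun i _ j _ hij => hind.indepFun hij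
  have h2 : (fun x : ι → α => ∑ i ∈ s, w i * f (x i)) =
      ∑ i ∈ s, fun x : ι → α => w i * f (x i) := by
    ext x; simp
  rw [h2, h, Finset.sum_mul]
  refine Finset.sum_congr rfl fun i _ => ?_
  rw [variance_const_mul, (identDistrib_eval hf i).variance_eq]

theorem integral_abs_le_sqrt {Ω : Type*} {mΩ : MeasurableSpace Ω} {P : Measure Ω}
    [IsProbabilityMeasure P] {g : Ω → ℝ} (hg : MemLp g 2 P) :
    ∫ x, |g x| ∂P ≤ √(∫ x, g x ^ 2 ∂P) := by
  refine Real.le_sqrt_of_sq_le ?_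
  have h := variance_nonneg (fun x => |g x|) P
  rw [show (fun x => |g x|) = |g| from rfl, variance_eq_sub hg.abs] at h
  simp only [Pi.pow_apply, Pi.abs_apply, sq_abs] at h
  linarith

theorem integral_abs_weighted_le {f : α → ℝ} (hf : Measurable f) (hf2 : MemLp f 2 κ)
    (s : Finset ι) (w : ι → ℝ) :
    ∫ x : ι → α, |∑ i ∈ s, w i * (f (x i) - ∫ a, f a ∂κ)| ∂(Measure.infinitePi fun _ : ι => κ) ≤
      √((∑ i ∈ s, w i ^ 2) * Var[f; κ]) := by
  have hm : MemLp (fun x : ι → α => ∑ i ∈ s, w i * f (x i)) 2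
      (Measure.infinitePi fun _ : ι => κ) :=
    memLp_finsetSum s fun i _ => (memLp_eval hf2 i).const_mul (w i)
  have hmean : ∫ x : ι → α, ∑ i ∈ s, w i * f (x i) ∂(Measure.infinitePi fun _ : ι => κ) =
      ∑ i ∈ s, w i * ∫ a, f a ∂κ := by
    rw [integral_finsetSum _ fun i _ =>
      ((memLp_eval hf2 i).integrable (by norm_num)).const_mul (w i)]
    refine Finset.sum_congr rfl fun i _ => ?_
    rw [integral_const_mul, (identDistrib_eval hf i).integral_eq]
  have heq : ∀ x : ι → α, ∑ i ∈ s, w i * (f (x i) - ∫ a, f a ∂κ) =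
      ∑ i ∈ s, w i * f (x i) - ∑ i ∈ s, w i * ∫ a, f a ∂κ := fun x => by
    simp [mul_sub, Finset.sum_sub_distrib]
  simp_rw [heq]
  refine (integral_abs_le_sqrt (hm.sub (memLp_const _))).trans ?_
  rw [← variance_weighted_sum hf hf2, variance_eq_integral hm.1.aemeasurable, hmean]
  rfl

/-- Weighted sums of i.i.d. integrable variables deviate little from their mean in `L¹` as soon as
the weights are spread out. -/
theorem exists_integral_abs_weighted_le {f : α → ℝ} (hf : Measurable f) (hfi : Integrable f κ)
    {ε : ℝ} (hε : 0 < ε) :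
    ∃ C : ℝ, 0 ≤ C ∧ ∀ (s : Finset ι) (w : ι → ℝ), (∀ i, 0 ≤ w i) →
      ∫ x : ι → α, |∑ i ∈ s, w i * (f (x i) - ∫ a, f a ∂κ)|
        ∂(Measure.infinitePi fun _ : ι => κ) ≤
      ε * ∑ i ∈ s, w i + C * √(∑ i ∈ s, w i ^ 2) := by
  -- Only a first moment is at hand, so `f` is replaced by a simple function, whose variance is
  -- finite. The error `ε / 2` is spent twice: on the sum of `|f - g|` and on the shift of the mean.
  obtain ⟨g, hg, -⟩ := (memLp_one_iff_integrable.2 hfi).exists_simpleFunc_eLpNorm_sub_lt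
    (by norm_num) (ε := ENNReal.ofReal (ε / 2)) (by simpa using hε)
  have hg2 : MemLp g 2 κ := SimpleFunc.memLp_of_isFiniteMeasure g 2 κ
  have hgi : Integrable g κ := hg2.integrable (by norm_num)
  have hgm : Measurable g := g.measurable
  have hd : ∫ a, |f a - g a| ∂κ ≤ ε / 2 := by
    have h := (integral_norm_eq_lintegral_enorm (hfi.sub hgi).1)
    simp only [Pi.sub_apply, Real.norm_eq_abs] at h
    rw [h]
    refine ENNReal.toReal_le_of_le_ofReal (by positivity) ?_
    rw [eLpNorm_one_eq_lintegral_enorm] at hg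
    exact hg.le
  have hd' : |∫ a, g a ∂κ - ∫ a, f a ∂κ| ≤ ε / 2 := by
    rw [← integral_sub hgi hfi]
    refine (abs_integral_le_integral_abs).trans ?_
    simpa [abs_sub_comm] using hd
  -- The constant depends on `ε` through `g`, but not on the weights.
  refine ⟨√(Var[g; κ]), Real.sqrt_nonneg _, fun s w hw => ?_⟩
  set P := Measure.infinitePi fun _ : ι => κ
  have hev : ∀ {h : α → ℝ}, Integrable h κ → ∀ i, Integrable (fun x : ι → α => h (x i)) P :=
    fun hh i => memLp_one_iff_integrable.1 (memLp_eval (memLp_one_iff_integrable.2 hh) i)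
  have i1 : ∀ i, Integrable (fun x : ι → α => |f (x i) - g (x i)|) P := fun i =>
    hev (h := fun a => |f a - g a|) (hfi.sub hgi).abs i
  have i2 : Integrable (fun x : ι → α => ∑ i ∈ s, w i * (g (x i) - ∫ a, g a ∂κ)) P :=
    integrable_finsetSum _ fun i _ => ((hev hgi i).sub (integrable_const _)).const_mul _
  have i3 : Integrable (fun x : ι → α => ∑ i ∈ s, w i * |f (x i) - g (x i)|) P :=
    integrable_finsetSum _ fun i _ => (i1 i).const_mul _
  have i0 : Integrable (fun x : ι → α => ∑ i ∈ s, w i * (f (x i) - ∫ a, f a ∂κ)) P :=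
    integrable_finsetSum _ fun i _ => ((hev hfi i).sub (integrable_const _)).const_mul _
  have hpt : ∀ x : ι → α, |∑ i ∈ s, w i * (f (x i) - ∫ a, f a ∂κ)| ≤
      (|∑ i ∈ s, w i * (g (x i) - ∫ a, g a ∂κ)| + ∑ i ∈ s, w i * |f (x i) - g (x i)|) +
        ε / 2 * ∑ i ∈ s, w i := fun x => by
    have e1 : ∑ i ∈ s, w i * (f (x i) - ∫ a, f a ∂κ) =
        ∑ i ∈ s, w i * (g (x i) - ∫ a, g a ∂κ) + ∑ i ∈ s, w i * (f (x i) - g (x i)) +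
          (∫ a, g a ∂κ - ∫ a, f a ∂κ) * ∑ i ∈ s, w i := by
      rw [Finset.mul_sum, ← Finset.sum_add_distrib, ← Finset.sum_add_distrib]
      exact Finset.sum_congr rfl fun i _ => by ring
    have e2 : |∑ i ∈ s, w i * (f (x i) - g (x i))| ≤ ∑ i ∈ s, w i * |f (x i) - g (x i)| := by
      refine (Finset.abs_sum_le_sum_abs _ _).trans_eq ?_
      exact Finset.sum_congr rfl fun i _ => by rw [abs_mul, abs_of_nonneg (hw i)]
    have e3 : |(∫ a, g a ∂κ - ∫ a, f a ∂κ) * ∑ i ∈ s, w i| ≤ ε / 2 * ∑ i ∈ s, w i := by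
      have hs : 0 ≤ ∑ i ∈ s, w i := Finset.sum_nonneg fun i _ => hw i
      rw [abs_mul, abs_of_nonneg hs]
      gcongr
    rw [e1]
    linarith [abs_add_three (∑ i ∈ s, w i * (g (x i) - ∫ a, g a ∂κ))
      (∑ i ∈ s, w i * (f (x i) - g (x i))) ((∫ a, g a ∂κ - ∫ a, f a ∂κ) * ∑ i ∈ s, w i)]
  have hsum : ∫ x, ∑ i ∈ s, w i * |f (x i) - g (x i)| ∂P ≤ ε / 2 * ∑ i ∈ s, w i := by
    rw [integral_finsetSum _ fun i _ => (i1 i).const_mul _, Finset.mul_sum]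
    refine Finset.sum_le_sum fun i _ => ?_
    rw [integral_const_mul, (identDistrib_eval (f := fun a => |f a - g a|)
      (by fun_prop) i).integral_eq, mul_comm]
    exact mul_le_mul_of_nonneg_right hd (hw i)
  have hI : ∫ x, |∑ i ∈ s, w i * (f (x i) - ∫ a, f a ∂κ)| ∂P ≤
      ∫ x, (|∑ i ∈ s, w i * (g (x i) - ∫ a, g a ∂κ)| + ∑ i ∈ s, w i * |f (x i) - g (x i)|) +
        ε / 2 * ∑ i ∈ s, w i ∂P :=
    integral_mono i0.abs ((i2.abs.add i3).add (integrable_const _)) hpt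
  rw [integral_add (f := fun x : ι → α => |∑ i ∈ s, w i * (g (x i) - ∫ a, g a ∂κ)| +
      ∑ i ∈ s, w i * |f (x i) - g (x i)|) (i2.abs.add i3) (integrable_const _),
    integral_add i2.abs i3, integral_const, probReal_univ, one_smul] at hI
  have h2 := integral_abs_weighted_le hgm hg2 s w
  rw [Real.sqrt_mul (Finset.sum_nonneg fun i _ => sq_nonneg _)] at h2
  linarith

theorem measurePreserving_shift (k : ℕ) :
    MeasurePreserving (fun (x : ℕ → α) i => x (k + i)) (Measure.infinitePi fun _ : ℕ => κ)
      (Measure.infinitePi fun _ : ℕ => κ) where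
  measurable := by fun_prop
  map_eq := by
    have h : iIndepFun (fun i (x : ℕ → α) => x i) (Measure.infinitePi fun _ : ℕ => κ) :=
      iIndepFun_infinitePi (X := fun _ a => a) fun _ => measurable_id
    rw [(h.precomp (add_right_injective k)).map_fun_eq_infinitePi_map (by fun_prop)]
    simp [Measure.infinitePi_map_eval]

/-- In `S_{n+1}² = S_n² + 2 S_n f(x_n) + f(x_n)²` the cross term integrates to zero over every event
of the past, by independence and centering, and the last term is nonnegative. The filtration is
generated by the first `n` coordinates; Doob's inequality needs no more than its existence. -/
theorem submartingale_sq_sum {f : α → ℝ} (hf : Measurable f) (hf2 : MemLp f 2 κ)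
    (hf0 : ∫ a, f a ∂κ = 0) :
    ∃ 𝒢 : Filtration ℕ (inferInstance : MeasurableSpace (ℕ → α)),
      Submartingale (fun n (x : ℕ → α) => (∑ i ∈ Finset.range n, f (x i)) ^ 2) 𝒢
        (Measure.infinitePi fun _ : ℕ => κ) := by
  set P := Measure.infinitePi fun _ : ℕ => κ
  let 𝒢 : Filtration ℕ (inferInstance : MeasurableSpace (ℕ → α)) :=
    { seq := fun n => MeasurableSpace.comap (fun (x : ℕ → α) (i : Finset.range n) => x i)
        inferInstance
      mono' := fun m n hmn => by
        refine MeasurableSpace.comap_le_iff_le_map.2 ?_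
        have hsub : Finset.range m ⊆ Finset.range n := Finset.range_mono hmn
        exact (show Measurable fun (y : Finset.range n → α) (i : Finset.range m) =>
          y ⟨i, hsub i.2⟩ by fun_prop).comp (comap_measurable _)
      le' := fun n => Measurable.comap_le (by fun_prop) }
  have hS2 : ∀ n, MemLp (fun x : ℕ → α => ∑ i ∈ Finset.range n, f (x i)) 2 P := fun n =>
    memLp_finsetSum _ fun i _ => memLp_eval hf2 i
  refine ⟨𝒢, submartingale_of_setIntegral_le_succ ?_ (fun n => (hS2 n).integrable_sq) ?_⟩
  · intro n
    have h : Measurable fun y : Finset.range n → α => (∑ i, f (y i)) ^ 2 := by fun_prop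
    refine Measurable.stronglyMeasurable ?_
    have h3 := h.comp (comap_measurable fun (x : ℕ → α) (i : Finset.range n) => x i)
    have h4 : ((fun y : Finset.range n → α => (∑ i, f (y i)) ^ 2) ∘
        fun (x : ℕ → α) (i : Finset.range n) => x i) =
        fun x : ℕ → α => (∑ i ∈ Finset.range n, f (x i)) ^ 2 := by
      ext x
      exact congrArg (· ^ 2) (Finset.sum_coe_sort (Finset.range n) fun i => f (x i))
    rwa [h4] at h3
  · rintro n s ⟨B, hB, rfl⟩
    set T : (ℕ → α) → Finset.range n → α := fun x i => x i with hT
    have hTm : Measurable T := by fun_prop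
    have hTB : MeasurableSet (T ⁻¹' B) := hTm hB
    have hind : IndepFun T (fun x : ℕ → α => x n) P := by
      have h : iIndepFun (fun i (x : ℕ → α) => x i) P :=
        iIndepFun_infinitePi (X := fun _ a => a) fun _ => measurable_id
      have h2 := h.indepFun_finset (Finset.range n) {n} (by simp) (by fun_prop)
      exact h2.comp (φ := id) (ψ := fun y : (({n} : Finset ℕ) → α) => y ⟨n, by simp⟩)
        measurable_id (by fun_prop)
    -- The past event is absorbed into a function of the first `n` coordinates, so that independence
    -- applies to a plain product.
    have hg : Measurable (B.indicator fun y : Finset.range n → α => ∑ i, f (y i)) :=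
      Measurable.indicator (by fun_prop) hB
    have hcross : ∫ x in T ⁻¹' B, (∑ i ∈ Finset.range n, f (x i)) * f (x n) ∂P = 0 := by
      have h := (hind.comp hg hf).integral_fun_mul_eq_mul_integral
        (hg.comp hTm).aestronglyMeasurable
        (hf.comp (measurable_pi_apply n)).aestronglyMeasurable
      simp only [Function.comp_apply] at h
      rw [(identDistrib_eval hf n).integral_eq, hf0, mul_zero] at h
      rw [← integral_indicator hTB, ← h]
      congr 1 with x
      by_cases hx : T x ∈ B
      · rw [Set.indicator_of_mem (show x ∈ T ⁻¹' B from hx), Set.indicator_of_mem hx]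
        exact congrArg (· * f (x n)) (Finset.sum_coe_sort (Finset.range n) fun i => f (x i)).symm
      · rw [Set.indicator_of_notMem (show x ∉ T ⁻¹' B from hx), Set.indicator_of_notMem hx,
          zero_mul]
    have hci : Integrable (fun x : ℕ → α => (∑ i ∈ Finset.range n, f (x i)) * f (x n)) P :=
      (hS2 n).integrable_mul (memLp_eval hf2 n)
    calc ∫ x in T ⁻¹' B, (∑ i ∈ Finset.range n, f (x i)) ^ 2 ∂P
        = ∫ x in T ⁻¹' B, ((∑ i ∈ Finset.range n, f (x i)) ^ 2 +
            2 * ((∑ i ∈ Finset.range n, f (x i)) * f (x n))) ∂P := by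
          rw [integral_add (hS2 n).integrable_sq.integrableOn (hci.const_mul 2).integrableOn,
            integral_const_mul, hcross]
          ring
      _ ≤ ∫ x in T ⁻¹' B, (∑ i ∈ Finset.range (n + 1), f (x i)) ^ 2 ∂P := by
          refine setIntegral_mono (((hS2 n).integrable_sq.add (hci.const_mul 2)).integrableOn)
            (hS2 (n + 1)).integrable_sq.integrableOn fun x => ?_
          simp only [Finset.sum_range_succ]
          nlinarith [sq_nonneg (f (x n))]

theorem integral_sq_sum {f : α → ℝ} (hf : Measurable f) (hf2 : MemLp f 2 κ)
    (hf0 : ∫ a, f a ∂κ = 0) (m : ℕ) :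
    ∫ x : ℕ → α, (∑ i ∈ Finset.range m, f (x i)) ^ 2 ∂(Measure.infinitePi fun _ : ℕ => κ) =
      m * Var[f; κ] := by
  have hS : MemLp (fun x : ℕ → α => ∑ i ∈ Finset.range m, f (x i)) 2
      (Measure.infinitePi fun _ : ℕ => κ) := memLp_finsetSum _ fun i _ => memLp_eval hf2 i
  have hm : ∫ x : ℕ → α, ∑ i ∈ Finset.range m, f (x i) ∂(Measure.infinitePi fun _ : ℕ => κ) =
      0 := by
    rw [integral_finsetSum _ fun i _ => (memLp_eval hf2 i).integrable (by norm_num)]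
    exact Finset.sum_eq_zero fun i _ => by rw [(identDistrib_eval hf i).integral_eq, hf0]
  have h := variance_weighted_sum hf hf2 (Finset.range m) fun _ => 1
  simp only [one_mul, one_pow, Finset.sum_const, Finset.card_range, nsmul_eq_mul, mul_one] at h
  rw [← h, variance_of_integral_eq_zero hS.1.aemeasurable hm]

/-- Kolmogorov's maximal inequality. -/
theorem measure_exists_le_abs_sum {f : α → ℝ} (hf : Measurable f) (hf2 : MemLp f 2 κ)
    (hf0 : ∫ a, f a ∂κ = 0) (m : ℕ) {r : ℝ} (hr : 0 < r) :
    (Measure.infinitePi fun _ : ℕ => κ).real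
      {x | ∃ k ≤ m, r ≤ |∑ i ∈ Finset.range k, f (x i)|} ≤ m * Var[f; κ] / r ^ 2 := by
  obtain ⟨𝒢, h𝒢⟩ := submartingale_sq_sum hf hf2 hf0
  set P := Measure.infinitePi fun _ : ℕ => κ
  obtain ⟨ε, hε⟩ : ∃ ε : ℝ≥0, (ε : ℝ) = r ^ 2 := ⟨⟨r ^ 2, by positivity⟩, rfl⟩
  -- Doob's inequality is applied to the squares, at level `r²`.
  have h := maximal_ineq h𝒢 (fun n x => sq_nonneg _) (ε := ε) m
  have hset : {x : ℕ → α | (ε : ℝ) ≤ (Finset.range (m + 1)).sup'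
        Finset.nonempty_range_add_one fun k => (∑ i ∈ Finset.range k, f (x i)) ^ 2} =
      {x : ℕ → α | ∃ k ≤ m, r ≤ |∑ i ∈ Finset.range k, f (x i)|} := by
    ext x
    simp only [Set.mem_ofPred_eq, hε, Finset.le_sup'_iff, Finset.mem_range,
      Order.lt_add_one_iff]
    refine exists_congr fun k => and_congr_right fun _ => ?_
    rw [← sq_abs (∑ i ∈ Finset.range k, f (x i)), pow_le_pow_iff_left₀ hr.le (abs_nonneg _)
      two_ne_zero]
  rw [hset] at h
  have hS : Integrable (fun x : ℕ → α => (∑ i ∈ Finset.range m, f (x i)) ^ 2) P :=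
    (memLp_finsetSum _ fun i _ => memLp_eval hf2 i).integrable_sq
  have hle := setIntegral_le_integral (s := {x : ℕ → α | ∃ k ≤ m, r ≤
    |∑ i ∈ Finset.range k, f (x i)|}) hS (Eventually.of_forall fun x => sq_nonneg _)
  rw [integral_sq_sum hf hf2 hf0] at hle
  have h2 := ENNReal.toReal_mono ENNReal.ofReal_ne_top
    (h.trans (ENNReal.ofReal_le_ofReal hle))
  have hv : 0 ≤ m * Var[f; κ] := mul_nonneg m.cast_nonneg (variance_nonneg _ _)
  rw [ENNReal.toReal_mul, ENNReal.toReal_ofReal hv, ENNReal.coe_toReal, hε] at h2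
  rw [le_div_iff₀ (by positivity), mul_comm]
  exact h2

end Product

/-! ### Moments of a single jump -/

section Step

variable {p : PMF ℤ}

theorem integrable_toMeasure_of_summable {f : ℤ → ℝ} (hf : Summable fun k => |f k| * (p k).toReal) :
    Integrable f p.toMeasure := by
  refine ⟨by fun_prop, ?_⟩
  rw [HasFiniteIntegral, lintegral_countable']
  have h : ∀ k, ‖f k‖ₑ * p.toMeasure {k} = ENNReal.ofReal (|f k| * (p k).toReal) := fun k => by
    rw [p.toMeasure_apply_singleton k (measurableSet_singleton k), ENNReal.ofReal_mul (abs_nonneg _),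
      ENNReal.ofReal_toReal (p.apply_ne_top k), Real.enorm_eq_ofReal_abs]
  simp_rw [h]
  rw [← ENNReal.ofReal_tsum_of_nonneg (fun k => by positivity) hf]
  exact ENNReal.ofReal_lt_top

theorem integrable_sq_step (hv : Summable fun k : ℤ => (k : ℝ) ^ 2 * (p k).toReal) :
    Integrable (fun k : ℤ => (k : ℝ) ^ 2) p.toMeasure :=
  integrable_toMeasure_of_summable (by simpa using hv)

theorem memLp_step (hv : Summable fun k : ℤ => (k : ℝ) ^ 2 * (p k).toReal) :
    MemLp (fun k : ℤ => (k : ℝ)) 2 p.toMeasure :=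
  (memLp_two_iff_integrable_sq (by fun_prop)).2 (integrable_sq_step hv)

theorem integral_sq_step (hv : Summable fun k : ℤ => (k : ℝ) ^ 2 * (p k).toReal) :
    ∫ k : ℤ, (k : ℝ) ^ 2 ∂p.toMeasure = ∑' k : ℤ, (k : ℝ) ^ 2 * (p k).toReal := by
  rw [PMF.integral_eq_tsum _ _ (integrable_sq_step hv)]
  exact tsum_congr fun k => by rw [smul_eq_mul, mul_comm]

theorem integral_step (hsymm : ∀ k : ℤ, p (-k) = p k)
    (hv : Summable fun k : ℤ => (k : ℝ) ^ 2 * (p k).toReal) :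
    ∫ k : ℤ, (k : ℝ) ∂p.toMeasure = 0 := by
  rw [PMF.integral_eq_tsum _ _ ((memLp_step hv).integrable (by norm_num))]
  have h := (Equiv.neg ℤ).tsum_eq fun k : ℤ => (p k).toReal • (k : ℝ)
  simp only [Equiv.neg_apply, hsymm, Int.cast_neg, smul_neg, tsum_neg] at h
  linarith

theorem integral_abs_step (hv : Summable fun k : ℤ => (k : ℝ) ^ 2 * (p k).toReal) :
    ∫ k : ℤ, |(k : ℝ)| ∂p.toMeasure = meanAbsJump p := by
  rw [PMF.integral_eq_tsum _ _ ((memLp_step hv).integrable (by norm_num)).abs]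
  exact tsum_congr fun k => by rw [smul_eq_mul, mul_comm]

theorem variance_step (hsymm : ∀ k : ℤ, p (-k) = p k)
    (hv : Summable fun k : ℤ => (k : ℝ) ^ 2 * (p k).toReal) :
    Var[fun k : ℤ => (k : ℝ); p.toMeasure] = ∑' k : ℤ, (k : ℝ) ^ 2 * (p k).toReal := by
  rw [variance_of_integral_eq_zero (by fun_prop) (integral_step hsymm hv), ← integral_sq_step hv]

/-- A vanishing mean of `|k|` would put all mass at `0` and force the second moment to vanish. -/
theorem meanAbsJump_pos (hv : Summable fun k : ℤ => (k : ℝ) ^ 2 * (p k).toReal)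
    (hv_pos : 0 < ∑' k : ℤ, (k : ℝ) ^ 2 * (p k).toReal) : 0 < meanAbsJump p := by
  have hi := ((memLp_step hv).integrable (by norm_num)).abs
  rw [← integral_abs_step hv]
  refine lt_of_le_of_ne (integral_nonneg fun k => abs_nonneg _) fun h0 => ?_
  have h := (integral_eq_zero_iff_of_nonneg (fun k => abs_nonneg _) hi).1 h0.symm
  rw [← integral_sq_step hv] at hv_pos
  refine hv_pos.ne' (integral_eq_zero_of_ae ?_)
  filter_upwards [h] with k hk
  simpa using hk

end Step

/-! ### The underlying walk: second moment, central limit theorem, escape from bounded sets -/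

section Walk

variable {p : PMF ℤ}

/-- The law of the increments of the underlying walk. -/
noncomputable abbrev stepLaw (p : PMF ℤ) : Measure (ℕ → ℤ) := Measure.infinitePi fun _ : ℕ => p.toMeasure

theorem cast_walk (ξ : ℕ → ℤ) (n : ℕ) :
    ((walkOfIncrements ξ n : ℤ) : ℝ) = ∑ i ∈ Finset.range n, (ξ i : ℝ) := by
  simp [walkOfIncrements]

theorem measurable_cast_walk (n : ℕ) :
    Measurable fun ξ : ℕ → ℤ => (walkOfIncrements ξ n : ℝ) :=
  (measurable_from_top (f := fun k : ℤ => (k : ℝ))).comp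
    ((measurable_pi_apply n).comp measurable_walkOfIncrements)

theorem walk_add (ξ : ℕ → ℤ) (a n : ℕ) :
    walkOfIncrements ξ (a + n) = walkOfIncrements ξ a + walkOfIncrements (fun i => ξ (a + i)) n := by
  simp [walkOfIncrements, Finset.sum_range_add]

theorem walk_succ_sub (ξ : ℕ → ℤ) (k : ℕ) :
    walkOfIncrements ξ (k + 1) - walkOfIncrements ξ k = ξ k := by
  simp [walkOfIncrements, Finset.sum_range_succ]

theorem memLp_walk (hv : Summable fun k : ℤ => (k : ℝ) ^ 2 * (p k).toReal) (n : ℕ) :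
    MemLp (fun ξ => (walkOfIncrements ξ n : ℝ)) 2 (stepLaw p) := by
  simp_rw [cast_walk]
  exact memLp_finsetSum _ fun i _ => memLp_eval (memLp_step hv) i

theorem integral_sq_walk (hsymm : ∀ k : ℤ, p (-k) = p k)
    (hv : Summable fun k : ℤ => (k : ℝ) ^ 2 * (p k).toReal) (n : ℕ) :
    ∫ ξ, (walkOfIncrements ξ n : ℝ) ^ 2 ∂stepLaw p =
      n * ∑' k : ℤ, (k : ℝ) ^ 2 * (p k).toReal := by
  simp_rw [cast_walk]
  rw [← variance_step hsymm hv]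
  exact integral_sq_sum measurable_from_top (memLp_step hv) (integral_step hsymm hv) n

/-- Variances of independent centred jumps add up, so the quotient is constant in `n`. At `n = 0` it
is `0 / 0 = 0`, whence the exclusion. -/
theorem normalizedMoment_two (hsymm : ∀ k : ℤ, p (-k) = p k)
    (hv : Summable fun k : ℤ => (k : ℝ) ^ 2 * (p k).toReal) {n : ℕ} (hn : n ≠ 0) :
    normalizedMoment p 2 n = ∑' k : ℤ, (k : ℝ) ^ 2 * (p k).toReal := by
  have h : Measurable fun S : ℕ → ℤ => |(S n : ℝ)| ^ (2 : ℝ) := by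
    have h2 : Measurable fun k : ℤ => |(k : ℝ)| ^ (2 : ℝ) := measurable_from_top
    exact h2.comp (measurable_pi_apply n)
  rw [normalizedMoment, walkLaw, integral_map measurable_walkOfIncrements.aemeasurable
    h.aestronglyMeasurable, div_self two_ne_zero, Real.rpow_one]
  simp_rw [Real.rpow_two, sq_abs]
  rw [integral_sq_walk hsymm hv]
  field_simp

theorem tendsto_normalizedMoment_two (hsymm : ∀ k : ℤ, p (-k) = p k)
    (hv : Summable fun k : ℤ => (k : ℝ) ^ 2 * (p k).toReal) :
    Tendsto (normalizedMoment p 2) atTop (𝓝 (∑' k : ℤ, (k : ℝ) ^ 2 * (p k).toReal)) := by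
  refine tendsto_const_nhds.congr' ?_
  filter_upwards [eventually_ne_atTop 0] with n hn
  exact (normalizedMoment_two hsymm hv hn).symm

theorem rescaledMoment_two (hsymm : ∀ k : ℤ, p (-k) = p k)
    (hv : Summable fun k : ℤ => (k : ℝ) ^ 2 * (p k).toReal) :
    rescaledMoment p 2 = ∑' k : ℤ, (k : ℝ) ^ 2 * (p k).toReal :=
  (tendsto_normalizedMoment_two hsymm hv).limUnder_eq

theorem tendstoInDistribution_walk (hsymm : ∀ k : ℤ, p (-k) = p k)
    (hv : Summable fun k : ℤ => (k : ℝ) ^ 2 * (p k).toReal) :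
    TendstoInDistribution (fun (n : ℕ) ξ => (√(n : ℝ))⁻¹ * (walkOfIncrements ξ n : ℝ)) atTop
      (id : ℝ → ℝ) (fun _ => stepLaw p)
      (gaussianReal 0 (∑' k : ℤ, (k : ℝ) ^ 2 * (p k).toReal).toNNReal) := by
  have hm : Measurable fun k : ℤ => (k : ℝ) := measurable_from_top
  have hid := fun i => identDistrib_eval (κ := p.toMeasure) hm i (ι := ℕ)
  have h := tendstoInDistribution_inv_sqrt_mul_sum_sub (P := stepLaw p)
    (P' := gaussianReal 0 (∑' k : ℤ, (k : ℝ) ^ 2 * (p k).toReal).toNNReal)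
    (X := fun i ξ => (ξ i : ℝ)) (Y := id) ?_ (memLp_eval (memLp_step hv) 0)
    (iIndepFun_infinitePi (X := fun _ (k : ℤ) => (k : ℝ)) fun _ => hm)
    fun i => (hid i).trans (hid 0).symm
  · rw [(hid 0).integral_eq, integral_step hsymm hv] at h
    simpa [cast_walk] using h
  · rw [(hid 0).variance_eq, variance_step hsymm hv]
    exact HasLaw.id

/-- On the scale `√n` the interval `[-K, K]` shrinks into every `[-δ, δ]`. The Gaussian limit has
positive variance, hence no atom at `0`, and the portmanteau theorem bounds the limsup by its mass
on `[-δ, δ]`, which is small with `δ`. -/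
theorem tendsto_measure_abs_walk_le (hsymm : ∀ k : ℤ, p (-k) = p k)
    (hv : Summable fun k : ℤ => (k : ℝ) ^ 2 * (p k).toReal)
    (hv_pos : 0 < ∑' k : ℤ, (k : ℝ) ^ 2 * (p k).toReal) (K : ℝ) :
    Tendsto (fun n => (stepLaw p).real {ξ | |(walkOfIncrements ξ n : ℝ)| ≤ K}) atTop (𝓝 0) := by
  set γ := gaussianReal 0 (∑' k : ℤ, (k : ℝ) ^ 2 * (p k).toReal).toNNReal
  have : NullSingletonClass γ := nullSingletonClass_gaussianReal (by simpa using hv_pos)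
  have hclt := (tendstoInDistribution_walk hsymm hv).tendsto
  have hγ : Tendsto (fun δ : ℝ => γ (Set.Icc (0 - δ) (0 + δ))) (𝓝[>] 0) (𝓝 0) :=
    (tendsto_measure_Icc γ 0).mono_left nhdsWithin_le_nhds
  refine (ENNReal.tendsto_toReal ENNReal.zero_ne_top).comp ?_
  refine ENNReal.tendsto_nhds_zero.2 fun ε hε => ?_
  obtain ⟨δ, hδε, hδ⟩ := ((hγ.eventually_lt_const hε).and self_mem_nhdsWithin).exists
  have hlim := ProbabilityMeasure.limsup_measure_closed_le_of_tendsto hclt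
    (isClosed_Icc (a := 0 - δ) (b := 0 + δ))
  simp only [ProbabilityMeasure.coe_mk, Measure.map_id] at hlim
  have hev := eventually_lt_of_limsup_lt (hlim.trans_lt hδε)
  have hs : Tendsto (fun n : ℕ => (√(n : ℝ))⁻¹ * K) atTop (𝓝 (0 * K)) :=
    ((tendsto_inv_atTop_zero.comp (Real.tendsto_sqrt_atTop.comp
      tendsto_natCast_atTop_atTop))).mul_const K
  rw [zero_mul] at hs
  filter_upwards [hev, hs.eventually_lt_const hδ] with n h1 h2
  rw [Measure.map_apply ((measurable_cast_walk n).const_mul _) measurableSet_Icc] at h1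
  refine (measure_mono fun ξ hξ => ?_).trans h1.le
  have h3 : |(√(n : ℝ))⁻¹ * (walkOfIncrements ξ n : ℝ)| ≤ δ := by
    rw [abs_mul, abs_of_nonneg (by positivity)]
    exact (mul_le_mul_of_nonneg_left hξ (by positivity)).trans h2.le
  rw [Set.mem_preimage, zero_sub, zero_add]
  exact abs_le.1 h3

end Walk

/-! ### Collision times as sums of gaps weighted by edge crossings -/

section Crossings

theorem target_sub_target (ζ : ℤ → Set.Ioi (0 : ℝ)) {a b : ℤ} (hab : a ≤ b) :
    target ζ b - target ζ a = ∑ j ∈ Finset.Ioc a b, (ζ j : ℝ) := by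
  induction b, hab using Int.leInduction with
  | base => simp
  | succ b hab ih =>
    have h : Finset.Ioc a (b + 1) = insert (b + 1) (Finset.Ioc a b) := by
      ext i; simp only [Finset.mem_Ioc, Finset.mem_insert]; omega
    rw [h, Finset.sum_insert (by simp), ← ih, target_eq_add ζ (b + 1), add_sub_cancel_right]
    ring

theorem abs_target_sub (ζ : ℤ → Set.Ioi (0 : ℝ)) (a b : ℤ) :
    |target ζ b - target ζ a| = ∑ j ∈ Finset.Ioc (min a b) (max a b), (ζ j : ℝ) := by
  rcases le_total a b with h | h
  · rw [min_eq_left h, max_eq_right h, ← target_sub_target ζ h,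
      abs_of_nonneg (sub_nonneg.2 ((target_strictMono ζ).monotone h))]
  · rw [min_eq_right h, max_eq_left h, ← target_sub_target ζ h, abs_sub_comm,
      abs_of_nonneg (sub_nonneg.2 ((target_strictMono ζ).monotone h))]

/-- The edges `(j - 1, j)` that the `k`-th jump crosses. -/
noncomputable def jumpEdges (S : ℕ → ℤ) (k : ℕ) : Finset ℤ :=
  Finset.Ioc (min (S k) (S (k + 1))) (max (S k) (S (k + 1)))

theorem card_jumpEdges (S : ℕ → ℤ) (k : ℕ) :
    ((jumpEdges S k).card : ℝ) = |((S (k + 1) - S k : ℤ) : ℝ)| := by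
  have h : ((jumpEdges S k).card : ℤ) = |S (k + 1) - S k| := by
    rw [jumpEdges, Int.card_Ioc, Int.toNat_of_nonneg (by simp), max_sub_min_eq_abs]
  rw [← Int.cast_abs, ← h]
  simp

/-- The number of the first `n` jumps that cross the edge `(j - 1, j)`. -/
noncomputable def crossings (S : ℕ → ℤ) (n : ℕ) (j : ℤ) : ℕ :=
  ((Finset.range n).filter fun k => j ∈ jumpEdges S k).card

/-- The edges crossed by the first `n` jumps. -/
noncomputable def crossedEdges (S : ℕ → ℤ) (n : ℕ) : Finset ℤ := (Finset.range n).biUnion (jumpEdges S)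

/-- Double counting of the pairs (jump, edge crossed by it). -/
theorem sum_sum_jumpEdges (S : ℕ → ℤ) (n : ℕ) (g : ℤ → ℝ) :
    ∑ k ∈ Finset.range n, ∑ j ∈ jumpEdges S k, g j =
      ∑ j ∈ crossedEdges S n, (crossings S n j : ℝ) * g j := by
  have h : ∀ k ∈ Finset.range n, ∑ j ∈ jumpEdges S k, g j =
      ∑ j ∈ crossedEdges S n, if j ∈ jumpEdges S k then g j else 0 := fun k hk => by
    rw [← Finset.sum_filter]
    refine Finset.sum_congr ?_ fun _ _ => rfl
    ext j
    simp only [Finset.mem_filter, crossedEdges, Finset.mem_biUnion]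
    exact ⟨fun hj => ⟨⟨k, hk, hj⟩, hj⟩, fun hj => hj.2⟩
  rw [Finset.sum_congr rfl h, Finset.sum_comm]
  refine Finset.sum_congr rfl fun j _ => ?_
  rw [← Finset.sum_filter, Finset.sum_const, nsmul_eq_mul, crossings]

theorem collisionTime_eq_sum (S : ℕ → ℤ) (ζ : ℤ → Set.Ioi (0 : ℝ)) (n : ℕ) :
    collisionTime S (envOfGaps ζ) n = ∑ k ∈ Finset.range n, ∑ j ∈ jumpEdges S k, (ζ j : ℝ) :=
  Finset.sum_congr rfl fun k _ => abs_target_sub ζ (S k) (S (k + 1))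

theorem sum_crossings (S : ℕ → ℤ) (n : ℕ) :
    ∑ j ∈ crossedEdges S n, (crossings S n j : ℝ) =
      ∑ k ∈ Finset.range n, |((S (k + 1) - S k : ℤ) : ℝ)| := by
  have h := sum_sum_jumpEdges S n fun _ => 1
  simp only [mul_one] at h
  rw [← h]
  refine Finset.sum_congr rfl fun k _ => ?_
  rw [← card_jumpEdges]; simp

/-- For a fixed walk this is a weighted sum of centred i.i.d. gaps, the form to which
`exists_integral_abs_weighted_le` applies. -/
theorem collisionTime_sub_eq_sum (S : ℕ → ℤ) (ζ : ℤ → Set.Ioi (0 : ℝ)) (n : ℕ) (m : ℝ) :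
    collisionTime S (envOfGaps ζ) n - m * ∑ k ∈ Finset.range n, |((S (k + 1) - S k : ℤ) : ℝ)| =
      ∑ j ∈ crossedEdges S n, (crossings S n j : ℝ) * ((ζ j : ℝ) - m) := by
  rw [collisionTime_eq_sum, sum_sum_jumpEdges, ← sum_crossings, Finset.mul_sum,
    ← Finset.sum_sub_distrib]
  exact Finset.sum_congr rfl fun j _ => by ring

/-- The square of a crossing number counts ordered pairs of jumps over the same edge. Summed over
edges this becomes pairwise overlaps, whose means can be estimated one pair at a time. -/
theorem sum_sq_crossings (S : ℕ → ℤ) (n : ℕ) :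
    ∑ j ∈ crossedEdges S n, (crossings S n j : ℝ) ^ 2 =
      ∑ k ∈ Finset.range n, ∑ l ∈ Finset.range n,
        ((jumpEdges S k ∩ jumpEdges S l).card : ℝ) := by
  simp_rw [sq]
  rw [← sum_sum_jumpEdges S n fun j => (crossings S n j : ℝ)]
  refine Finset.sum_congr rfl fun k _ => ?_
  have h : ∀ j, (crossings S n j : ℝ) =
      ∑ l ∈ Finset.range n, if j ∈ jumpEdges S l then (1 : ℝ) else 0 := fun j => by
    simp [crossings]
  simp_rw [h]
  rw [Finset.sum_comm]
  refine Finset.sum_congr rfl fun l _ => ?_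
  rw [← Finset.sum_filter, Finset.sum_const, nsmul_eq_mul, mul_one, Finset.filter_mem_eq_inter]

/-- The overlap is at most the length `x` of jump `k`. If one of the lengths `x`, `y` exceeds `K`,
then `x ≤ (2x² + 2y²) / K`. Otherwise a common edge lies within `K` of both `S (k + 1)` and `S l`,
which are then at distance at most `2K`, and the overlap is at most `K`. For `k < l` the difference
`S l - S (k + 1)` is distributed like a walk after `l - k - 1` steps. -/
theorem card_inter_jumpEdges_le (S : ℕ → ℤ) (k l : ℕ) {K : ℝ} (hK : 0 < K) :
    ((jumpEdges S k ∩ jumpEdges S l).card : ℝ) ≤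
      (2 * ((S (k + 1) - S k : ℤ) : ℝ) ^ 2 + 2 * ((S (l + 1) - S l : ℤ) : ℝ) ^ 2) / K +
        K * ({y : ℤ | |(y : ℝ)| ≤ 2 * K}.indicator 1 (S l - S (k + 1)) : ℝ) := by
  classical
  have hcard : ((jumpEdges S k ∩ jumpEdges S l).card : ℝ) ≤ |((S (k + 1) - S k : ℤ) : ℝ)| := by
    rw [← card_jumpEdges]
    exact_mod_cast Finset.card_le_card Finset.inter_subset_left
  have hind : 0 ≤ ({y : ℤ | |(y : ℝ)| ≤ 2 * K}.indicator 1 (S l - S (k + 1)) : ℝ) :=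
    Set.indicator_nonneg (fun _ _ => zero_le_one) _
  have hx2 := sq_abs ((S (k + 1) - S k : ℤ) : ℝ)
  have hy2 := sq_abs ((S (l + 1) - S l : ℤ) : ℝ)
  rcases (jumpEdges S k ∩ jumpEdges S l).eq_empty_or_nonempty with he | ⟨j, hj⟩
  · rw [he, Finset.card_empty, Nat.cast_zero]; positivity
  have hk0 := abs_nonneg ((S (k + 1) - S k : ℤ) : ℝ)
  have hl0 := abs_nonneg ((S (l + 1) - S l : ℤ) : ℝ)
  have hjk : |j - S (k + 1)| ≤ |S (k + 1) - S k| ∧ |j - S l| ≤ |S (l + 1) - S l| := by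
    simp only [Finset.mem_inter, jumpEdges, Finset.mem_Ioc] at hj
    constructor <;> rw [abs_le] <;>
      rcases abs_cases (S (k + 1) - S k) with h | h <;>
      rcases abs_cases (S (l + 1) - S l) with h' | h' <;> omega
  set x := |((S (k + 1) - S k : ℤ) : ℝ)| with hx
  set y := |((S (l + 1) - S l : ℤ) : ℝ)| with hy
  rw [← hx2, ← hy2]
  refine hcard.trans ?_
  by_cases hxK : K < x
  · have : x ≤ (2 * x ^ 2 + 2 * y ^ 2) / K := by
      rw [le_div_iff₀ hK]; nlinarith
    linarith [mul_nonneg hK.le hind]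
  by_cases hyK : K < y
  · have : x ≤ (2 * x ^ 2 + 2 * y ^ 2) / K := by
      rw [le_div_iff₀ hK]; nlinarith [sq_nonneg (x - y)]
    linarith [mul_nonneg hK.le hind]
  have hmem : S l - S (k + 1) ∈ {y : ℤ | |(y : ℝ)| ≤ 2 * K} := by
    have h1 : |(j : ℝ) - S (k + 1)| ≤ x := by rw [hx]; exact_mod_cast hjk.1
    have h2 : |(j : ℝ) - S l| ≤ y := by rw [hy]; exact_mod_cast hjk.2
    simp only [Set.mem_ofPred_eq, Int.cast_sub]
    rw [abs_le] at *
    constructor <;> linarith [h1.1, h1.2, h2.1, h2.2]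
  rw [Set.indicator_of_mem hmem, Pi.one_apply, mul_one]
  have : 0 ≤ (2 * x ^ 2 + 2 * y ^ 2) / K := by positivity
  linarith

end Crossings

/-! ### The mean total overlap of the jumps is `o(n²)` -/

section Overlap

variable {p : PMF ℤ}

theorem map_walk_sub (a m : ℕ) :
    (stepLaw p).map (fun ξ => walkOfIncrements ξ (a + m) - walkOfIncrements ξ a) =
      (stepLaw p).map fun ξ => walkOfIncrements ξ m := by
  have h := (measurePreserving_shift (κ := p.toMeasure) a).map_eq
  have hm : Measurable fun ξ => walkOfIncrements ξ m :=
    (measurable_pi_apply m).comp measurable_walkOfIncrements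
  conv_rhs => rw [stepLaw, ← h]
  rw [Measure.map_map hm (by fun_prop)]
  congr 1 with ξ
  simp [walk_add]

theorem integrable_card_inter (hv : Summable fun k : ℤ => (k : ℝ) ^ 2 * (p k).toReal) (k l : ℕ) :
    Integrable (fun ξ => ((jumpEdges (walkOfIncrements ξ) k ∩
      jumpEdges (walkOfIncrements ξ) l).card : ℝ)) (stepLaw p) := by
  have hw : ∀ m, Measurable fun ξ => walkOfIncrements ξ m := fun m =>
    (measurable_pi_apply m).comp measurable_walkOfIncrements
  have hF : ∀ F : (ℤ × ℤ) × ℤ × ℤ → ℝ, Measurable fun ξ => F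
      ((walkOfIncrements ξ k, walkOfIncrements ξ (k + 1)),
        walkOfIncrements ξ l, walkOfIncrements ξ (l + 1)) := fun F =>
    (measurable_of_countable F).comp
      (((hw k).prodMk (hw (k + 1))).prodMk ((hw l).prodMk (hw (l + 1))))
  have hm : Measurable fun ξ => ((jumpEdges (walkOfIncrements ξ) k ∩
      jumpEdges (walkOfIncrements ξ) l).card : ℝ) :=
    hF fun q => ((Finset.Ioc (min q.1.1 q.1.2) (max q.1.1 q.1.2) ∩
        Finset.Ioc (min q.2.1 q.2.2) (max q.2.1 q.2.2)).card : ℝ)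
  refine ((memLp_eval (memLp_step hv) k).integrable (by norm_num)).abs.mono'
    hm.aestronglyMeasurable (Eventually.of_forall fun ξ => ?_)
  rw [Real.norm_of_nonneg (Nat.cast_nonneg _), ← walk_succ_sub ξ k, ← card_jumpEdges]
  exact_mod_cast Finset.card_le_card Finset.inter_subset_left

theorem integral_card_inter_le
    (hv : Summable fun k : ℤ => (k : ℝ) ^ 2 * (p k).toReal) {k l : ℕ} (hkl : k < l)
    {K : ℝ} (hK : 0 < K) :
    ∫ ξ, ((jumpEdges (walkOfIncrements ξ) k ∩
      jumpEdges (walkOfIncrements ξ) l).card : ℝ) ∂stepLaw p ≤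
      4 * (∑' k : ℤ, (k : ℝ) ^ 2 * (p k).toReal) / K +
        K * (stepLaw p).real {ξ | |(walkOfIncrements ξ (l - (k + 1)) : ℝ)| ≤ 2 * K} := by
  set s : Set ℤ := {y : ℤ | |(y : ℝ)| ≤ 2 * K}
  have hw : ∀ m, Measurable fun ξ => walkOfIncrements ξ m := fun m =>
    (measurable_pi_apply m).comp measurable_walkOfIncrements
  have hsq : ∀ i : ℕ, Integrable (fun ξ : ℕ → ℤ => (ξ i : ℝ) ^ 2) (stepLaw p) := fun i =>
    (memLp_eval (memLp_step hv) i).integrable_sq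
  have hsqi : ∀ i : ℕ, ∫ ξ : ℕ → ℤ, (ξ i : ℝ) ^ 2 ∂stepLaw p =
      ∑' k : ℤ, (k : ℝ) ^ 2 * (p k).toReal := fun i => by
    rw [← integral_sq_step hv]
    exact (identDistrib_eval (f := fun k : ℤ => (k : ℝ) ^ 2) measurable_from_top i).integral_eq
  set R : (ℕ → ℤ) → ℤ := fun ξ => walkOfIncrements ξ l - walkOfIncrements ξ (k + 1)
  have hR : Measurable R := (hw l).sub (hw (k + 1))
  have hs : MeasurableSet (R ⁻¹' s) := hR (MeasurableSet.of_discrete)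
  have hRs : (stepLaw p).real (R ⁻¹' s) =
      (stepLaw p).real {ξ | |(walkOfIncrements ξ (l - (k + 1)) : ℝ)| ≤ 2 * K} := by
    have h := map_walk_sub (p := p) (k + 1) (l - (k + 1))
    rw [Nat.add_sub_cancel' (by omega)] at h
    have h2 := congrArg (fun μ : Measure ℤ => μ.real s) h
    rwa [map_measureReal_apply hR MeasurableSet.of_discrete,
      map_measureReal_apply (hw _) MeasurableSet.of_discrete] at h2
  have i1 : Integrable (fun ξ : ℕ → ℤ => (2 * (ξ k : ℝ) ^ 2 + 2 * (ξ l : ℝ) ^ 2) / K)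
      (stepLaw p) := (((hsq k).const_mul 2).add ((hsq l).const_mul 2)).div_const K
  have i2 : Integrable (fun ξ : ℕ → ℤ => K * ((R ⁻¹' s).indicator 1 ξ : ℝ)) (stepLaw p) :=
    ((integrable_const (1 : ℝ)).indicator hs).const_mul K
  calc _ ≤ ∫ ξ, ((2 * (ξ k : ℝ) ^ 2 + 2 * (ξ l : ℝ) ^ 2) / K +
        K * ((R ⁻¹' s).indicator 1 ξ : ℝ)) ∂stepLaw p := by
        refine integral_mono (integrable_card_inter hv k l) (i1.add i2) fun ξ => ?_
        have h := card_inter_jumpEdges_le (walkOfIncrements ξ) k l hK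
        rwa [walk_succ_sub, walk_succ_sub] at h
    _ = _ := by
        rw [integral_add i1 i2, integral_div, integral_add ((hsq k).const_mul 2)
          ((hsq l).const_mul 2), integral_const_mul, integral_const_mul, integral_const_mul,
          hsqi, hsqi, integral_indicator_one hs, hRs]
        ring

/-- On the diagonal the overlap is `|ξ k|`, which is at most `(ξ k)²` since jumps are integers. -/
theorem integral_card_inter_self_le (hv : Summable fun k : ℤ => (k : ℝ) ^ 2 * (p k).toReal)
    (k : ℕ) :
    ∫ ξ, ((jumpEdges (walkOfIncrements ξ) k ∩
      jumpEdges (walkOfIncrements ξ) k).card : ℝ) ∂stepLaw p ≤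
      ∑' k : ℤ, (k : ℝ) ^ 2 * (p k).toReal := by
  rw [← integral_sq_step hv, ← (identDistrib_eval (κ := p.toMeasure) (ι := ℕ)
    (f := fun k : ℤ => (k : ℝ) ^ 2) measurable_from_top k).integral_eq]
  refine integral_mono (integrable_card_inter hv k k)
    (memLp_eval (memLp_step hv) k).integrable_sq fun ξ => ?_
  simp only [Finset.inter_self]
  rw [card_jumpEdges, walk_succ_sub, ← sq_abs, ← Int.cast_abs]
  exact_mod_cast Int.le_self_sq _

/-- Passing from `n` to `n + 1` adds a row, an equal column and a diagonal entry. Along the column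
the lag `n - (k + 1)` runs once through `0, …, n - 1`, which produces the sum of return
probabilities. -/
theorem sum_integral_card_inter_le
    (hv : Summable fun k : ℤ => (k : ℝ) ^ 2 * (p k).toReal) {K : ℝ} (hK : 0 < K) (n : ℕ) :
    ∑ k ∈ Finset.range n, ∑ l ∈ Finset.range n,
      ∫ ξ, ((jumpEdges (walkOfIncrements ξ) k ∩
        jumpEdges (walkOfIncrements ξ) l).card : ℝ) ∂stepLaw p ≤
      n * (∑' k : ℤ, (k : ℝ) ^ 2 * (p k).toReal) +
      n ^ 2 * (4 * (∑' k : ℤ, (k : ℝ) ^ 2 * (p k).toReal) / K) +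
      2 * K * n * ∑ m ∈ Finset.range n,
        (stepLaw p).real {ξ | |(walkOfIncrements ξ m : ℝ)| ≤ 2 * K} := by
  set v := ∑' k : ℤ, (k : ℝ) ^ 2 * (p k).toReal
  set π : ℕ → ℝ := fun m => (stepLaw p).real {ξ | |(walkOfIncrements ξ m : ℝ)| ≤ 2 * K}
  induction n with
  | zero => simp
  | succ n ih =>
    have hcol : ∑ k ∈ Finset.range n, ∫ ξ, ((jumpEdges (walkOfIncrements ξ) k ∩
        jumpEdges (walkOfIncrements ξ) n).card : ℝ) ∂stepLaw p ≤
        n * (4 * v / K) + K * ∑ m ∈ Finset.range n, π m := by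
      refine (Finset.sum_le_sum fun k hk =>
        integral_card_inter_le hv (Finset.mem_range.1 hk) hK).trans_eq ?_
      rw [Finset.sum_add_distrib, Finset.sum_const, Finset.card_range, nsmul_eq_mul,
        ← Finset.mul_sum, ← Finset.sum_range_reflect π n]
      congr 2
      refine Finset.sum_congr rfl fun k _ => ?_
      rw [show n - (k + 1) = n - 1 - k by omega]
    have hrow : ∑ l ∈ Finset.range n, ∫ ξ, ((jumpEdges (walkOfIncrements ξ) n ∩
        jumpEdges (walkOfIncrements ξ) l).card : ℝ) ∂stepLaw p ≤
        n * (4 * v / K) + K * ∑ m ∈ Finset.range n, π m := by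
      refine le_of_eq_of_le (Finset.sum_congr rfl fun l _ => ?_) hcol
      simp_rw [Finset.inter_comm]
    have hdiag := integral_card_inter_self_le hv n (p := p)
    have hv0 : 0 ≤ v := tsum_nonneg fun k => by positivity
    have hπ : ∀ m, 0 ≤ π m := fun m => measureReal_nonneg
    have hs : 0 ≤ ∑ m ∈ Finset.range n, π m := Finset.sum_nonneg fun m _ => hπ m
    simp only [Finset.sum_range_succ, Finset.sum_add_distrib]
    push_cast
    have h1 : 0 ≤ 4 * v / K := by positivity
    have h2 : 0 ≤ 2 * K * (n + 1) * π n := by have := hπ n; positivity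
    nlinarith

/-- The choice `K = 8v / ε` turns the long-jump term into `(ε / 2) n²`. With `K` fixed, the
remaining terms are `o(n²)`, because Cesàro means of the vanishing return probabilities vanish. -/
theorem eventually_integral_sum_card_inter_le (hsymm : ∀ k : ℤ, p (-k) = p k)
    (hv : Summable fun k : ℤ => (k : ℝ) ^ 2 * (p k).toReal)
    (hv_pos : 0 < ∑' k : ℤ, (k : ℝ) ^ 2 * (p k).toReal) {ε : ℝ} (hε : 0 < ε) :
    ∀ᶠ n : ℕ in atTop, ∑ k ∈ Finset.range n, ∑ l ∈ Finset.range n,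
      ∫ ξ, ((jumpEdges (walkOfIncrements ξ) k ∩
        jumpEdges (walkOfIncrements ξ) l).card : ℝ) ∂stepLaw p ≤ ε * (n : ℝ) ^ 2 := by
  set v := ∑' k : ℤ, (k : ℝ) ^ 2 * (p k).toReal with hvdef
  set K := 8 * v / ε with hKdef
  have hK : 0 < K := by positivity
  have hces := ((tendsto_measure_abs_walk_le hsymm hv hv_pos (2 * K)).cesaro.const_mul
    (2 * K)).add (tendsto_inv_atTop_nhds_zero_nat.const_mul v)
  rw [mul_zero, mul_zero, add_zero] at hces
  filter_upwards [hces.eventually_lt_const (half_pos hε), eventually_gt_atTop 0] with n hn hn0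
  refine (sum_integral_card_inter_le hv hK n).trans ?_
  have hn' : (0 : ℝ) < n := by exact_mod_cast hn0
  have h4 : 4 * v / K = ε / 2 := by rw [hKdef]; field_simp; norm_num
  rw [← hvdef, h4]
  have h5 := mul_le_mul_of_nonneg_left hn.le (sq_nonneg (n : ℝ))
  have h6 : ∀ s : ℝ, (n : ℝ) ^ 2 * (2 * K * ((n : ℝ)⁻¹ * s) + v * (n : ℝ)⁻¹) =
      n * v + 2 * K * n * s := fun s => by field_simp; ring
  rw [h6] at h5
  linarith

end Overlap

/-! ### Laws of large numbers under the product law of walk and gaps -/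

section Joint

/-- Markov's inequality after Fubini. It lets the gaps be averaged with the walk frozen, and the
resulting bound `b` be averaged over the walk. -/
theorem prod_real_le_of_integral_abs_le {A B : Type*} {mA : MeasurableSpace A}
    {mB : MeasurableSpace B} {P : Measure A} {Q : Measure B} [IsProbabilityMeasure P]
    [IsProbabilityMeasure Q] {F : A × B → ℝ} (hF : Measurable F) {b : A → ℝ}
    (hb : Integrable b P) (hFi : ∀ a, Integrable (fun y => F (a, y)) Q)
    (hFb : ∀ a, ∫ y, |F (a, y)| ∂Q ≤ b a) {r : ℝ} (hr : 0 < r) :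
    (P.prod Q).real {x | r ≤ |F x|} ≤ (∫ a, b a ∂P) / r := by
  have hi : Integrable F (P.prod Q) := by
    refine (integrable_prod_iff hF.aestronglyMeasurable).2 ⟨Eventually.of_forall hFi, ?_⟩
    refine hb.mono' hF.aestronglyMeasurable.norm.integral_prod_right'
      (Eventually.of_forall fun a => ?_)
    rw [Real.norm_of_nonneg (integral_nonneg fun _ => norm_nonneg _)]
    exact hFb a
  have h := mul_meas_ge_le_integral_of_nonneg (Eventually.of_forall fun x => abs_nonneg (F x))
    hi.abs r
  rw [le_div_iff₀ hr, mul_comm]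
  refine h.trans ?_
  rw [integral_prod _ hi.abs]
  exact integral_mono hi.abs.integral_prod_left hb hFb

variable {ν : Measure (Set.Ioi (0 : ℝ))} [IsProbabilityMeasure ν] {p : PMF ℤ}

/-- The law of the gaps. -/
noncomputable abbrev gapLaw (ν : Measure (Set.Ioi (0 : ℝ))) [IsProbabilityMeasure ν] :
    Measure (ℤ → Set.Ioi (0 : ℝ)) := Measure.infinitePi fun _ : ℤ => ν

theorem measurable_walk_env : Measurable fun x : (ℕ → ℤ) × (ℤ → Set.Ioi (0 : ℝ)) =>
    (walkOfIncrements x.1, envOfGaps x.2) :=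
  (measurable_walkOfIncrements.comp measurable_fst).prodMk
    (measurable_envOfGaps.comp measurable_snd)

theorem meanGap_pos (hν : Integrable (fun z : Set.Ioi (0 : ℝ) => (z : ℝ)) ν) : 0 < meanGap ν := by
  refine lt_of_le_of_ne (integral_nonneg fun z => z.2.le) fun h0 => ?_
  have h := (integral_eq_zero_iff_of_nonneg (fun z : Set.Ioi (0 : ℝ) => z.2.le) hν).1 h0.symm
  obtain ⟨z, hz⟩ := h.exists
  exact (show (0 : ℝ) < z from z.2).ne' hz

theorem integrable_weighted_gaps (hν : Integrable (fun z : Set.Ioi (0 : ℝ) => (z : ℝ)) ν)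
    (s : Finset ℤ) (w : ℤ → ℝ) (m : ℝ) :
    Integrable (fun ζ : ℤ → Set.Ioi (0 : ℝ) => ∑ j ∈ s, w j * ((ζ j : ℝ) - m)) (gapLaw ν) :=
  integrable_finsetSum _ fun j _ => ((memLp_one_iff_integrable.1
    (memLp_eval (memLp_one_iff_integrable.2 hν) j)).sub (integrable_const _)).const_mul _

/-- Both signs of `j` are covered by one sum; the factor `1` is kept as the weight in
`exists_integral_abs_weighted_le`. -/
theorem target_sub_mul (ζ : ℤ → Set.Ioi (0 : ℝ)) (m : ℝ) (j : ℤ) :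
    |target ζ j - m * j| =
      |∑ i ∈ Finset.Ioc (min 0 j) (max 0 j), 1 * ((ζ i : ℝ) - m)| := by
  simp only [one_mul, Finset.sum_sub_distrib, Finset.sum_const, Int.card_Ioc, nsmul_eq_mul]
  rcases le_total 0 j with h | h
  · rw [min_eq_left h, max_eq_right h, ← target_sub_target ζ h, target_zero, sub_zero, sub_zero,
      mul_comm]
    congr 3
    exact_mod_cast (Int.toNat_of_nonneg h).symm
  · rw [min_eq_right h, max_eq_left h, ← target_sub_target ζ h, target_zero, zero_sub,
      abs_sub_comm (- target ζ j)]
    congr 1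
    have : ((0 - j).toNat : ℝ) = -j := by
      exact_mod_cast (Int.toNat_of_nonneg (show 0 ≤ 0 - j by omega)).trans (zero_sub j)
    rw [this]; ring

theorem exists_integral_abs_target_sub_le
    (hν : Integrable (fun z : Set.Ioi (0 : ℝ) => (z : ℝ)) ν) {ε : ℝ} (hε : 0 < ε) :
    ∃ C : ℝ, ∀ j : ℤ, Integrable (fun ζ => target ζ j - meanGap ν * j) (gapLaw ν) ∧
      ∫ ζ, |target ζ j - meanGap ν * j| ∂gapLaw ν ≤ ε * |(j : ℝ)| + C := by
  obtain ⟨C, hC, h⟩ := exists_integral_abs_weighted_le (ι := ℤ) (κ := ν)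
    (f := fun z : Set.Ioi (0 : ℝ) => (z : ℝ)) measurable_subtype_coe hν (half_pos hε)
  -- The weak law gives `(ε / 2) |j| + C √|j|`; completing the square trades the root for another
  -- `(ε / 2) |j|` and this constant. The bound, affine in `|j|`, can be averaged over a random site
  -- with only `E|S_n + c|` known.
  refine ⟨C ^ 2 / (2 * ε), fun j => ⟨?_, ?_⟩⟩
  · have hm : Measurable fun ζ => target ζ j - meanGap ν * j := by unfold target; fun_prop
    refine (integrable_weighted_gaps hν (Finset.Ioc (min 0 j) (max 0 j)) (fun _ => 1)
      (meanGap ν)).mono hm.aestronglyMeasurable (Eventually.of_forall fun ζ => ?_)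
    exact (target_sub_mul ζ _ j).le
  · simp_rw [target_sub_mul]
    refine (h (Finset.Ioc (min 0 j) (max 0 j)) (fun _ => 1) fun _ => zero_le_one).trans ?_
    have hcard : (((max 0 j - min 0 j).toNat : ℕ) : ℝ) = |(j : ℝ)| := by
      have h2 : (((max 0 j - min 0 j).toNat : ℕ) : ℤ) = |j| := by
        rw [max_sub_min_eq_abs, sub_zero, Int.toNat_of_nonneg (abs_nonneg _)]
      exact_mod_cast h2
    simp only [one_pow, Finset.sum_const, Int.card_Ioc, nsmul_eq_mul, mul_one]
    rw [hcard]
    have hs := Real.sq_sqrt (abs_nonneg (j : ℝ))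
    have h3 : C * √|(j : ℝ)| ≤ ε / 2 * |(j : ℝ)| + C ^ 2 / (2 * ε) := by
      have h4 : ε / 2 * |(j : ℝ)| + C ^ 2 / (2 * ε) - C * √|(j : ℝ)| =
          (ε * √|(j : ℝ)| - C) ^ 2 / (2 * ε) := by
        rw [← hs, Real.sqrt_sq (Real.sqrt_nonneg _)]
        field_simp; ring
      have : 0 ≤ (ε * √|(j : ℝ)| - C) ^ 2 / (2 * ε) := by positivity
      linarith
    linarith

theorem measurable_target_walk_sub (n : ℕ) (c : ℤ) (m : ℝ) :
    Measurable fun x : (ℕ → ℤ) × (ℤ → Set.Ioi (0 : ℝ)) =>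
      target x.2 (walkOfIncrements x.1 n + c) - m * (walkOfIncrements x.1 n + c : ℤ) := by
  have h1 : Measurable fun x : (ℕ → ℤ) × Env => x.1 n + c :=
    (measurable_walkEval n).add_const c
  have h2 : Measurable fun k : ℤ => m * (k : ℝ) := measurable_from_top
  have h3 : Measurable fun x : (ℕ → ℤ) × Env => x.2 (x.1 n + c) - m * (x.1 n + c : ℤ) :=
    (measurable_envEval h1).sub (h2.comp h1)
  exact h3.comp measurable_walk_env

/-- The law of large numbers for the environment at the random site `S_n + c`. -/
theorem exists_measure_target_walk_le (hν : Integrable (fun z : Set.Ioi (0 : ℝ) => (z : ℝ)) ν)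
    (hsymm : ∀ k : ℤ, p (-k) = p k)
    (hv : Summable fun k : ℤ => (k : ℝ) ^ 2 * (p k).toReal) {A δ ε : ℝ} (hA : 0 < A)
    (hδ : 0 < δ) (hε : 0 < ε) :
    ∃ r₀ : ℝ, ∀ r, r₀ ≤ r → ∀ (n : ℕ) (c : ℤ),
      √(n * ∑' k : ℤ, (k : ℝ) ^ 2 * (p k).toReal) + |(c : ℝ)| ≤ A * r →
      ((stepLaw p).prod (gapLaw ν)).real {x | δ * r ≤
        |target x.2 (walkOfIncrements x.1 n + c) -
          meanGap ν * (walkOfIncrements x.1 n + c : ℤ)|} ≤ ε := by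
  obtain ⟨C, hC⟩ := exists_integral_abs_target_sub_le hν
    (ε := ε * δ / (2 * A)) (by positivity)
  -- The slope `ε δ / (2A)` against `E|S_n + c| ≤ A r` costs `ε δ r / 2`, and this threshold makes
  -- `C` cost no more than the same amount; the `1` keeps `r` positive.
  refine ⟨max 1 (2 * C / (ε * δ)), fun r hr n c hnc => ?_⟩
  have hr1 : 1 ≤ r := (le_max_left _ _).trans hr
  have hr2 : 2 * C / (ε * δ) ≤ r := (le_max_right _ _).trans hr
  rw [div_le_iff₀ (by positivity)] at hr2
  have hwi := memLp_walk hv n (p := p)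
  have hi : Integrable (fun ξ => |((walkOfIncrements ξ n + c : ℤ) : ℝ)|) (stepLaw p) := by
    push_cast
    exact ((hwi.integrable (by norm_num)).add (integrable_const (c : ℝ))).abs
  have hE : ∫ ξ, |((walkOfIncrements ξ n + c : ℤ) : ℝ)| ∂stepLaw p ≤ A * r := by
    refine le_trans ?_ hnc
    have h1 := integral_abs_le_sqrt hwi
    rw [integral_sq_walk hsymm hv] at h1
    have h2 : ∫ ξ, |((walkOfIncrements ξ n + c : ℤ) : ℝ)| ∂stepLaw p ≤
        ∫ ξ, (|(walkOfIncrements ξ n : ℝ)| + |(c : ℝ)|) ∂stepLaw p := by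
      refine integral_mono hi ((hwi.integrable (by norm_num)).abs.add (integrable_const _))
        fun ξ => ?_
      push_cast
      exact abs_add_le _ _
    rw [integral_add (hwi.integrable (by norm_num)).abs (integrable_const _), integral_const,
      probReal_univ, one_smul] at h2
    linarith
  have hm := measurable_target_walk_sub n c (meanGap ν)
  refine (prod_real_le_of_integral_abs_le hm
    (b := fun ξ => ε * δ / (2 * A) * |((walkOfIncrements ξ n + c : ℤ) : ℝ)| + C)
    ((hi.const_mul _).add (integrable_const _)) (fun ξ => (hC (walkOfIncrements ξ n + c)).1)
    (fun ξ => (hC (walkOfIncrements ξ n + c)).2) (by positivity)).trans ?_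
  rw [integral_add (hi.const_mul _) (integrable_const _), integral_const_mul, integral_const,
    probReal_univ, one_smul, div_le_iff₀ (by positivity)]
  have h5 := mul_le_mul_of_nonneg_left hE (show 0 ≤ ε * δ / (2 * A) by positivity)
  have h6 : ε * δ / (2 * A) * (A * r) = ε * δ * r / 2 := by field_simp
  linarith

/-- Separates the two sources of error: the fluctuation of the gaps for a given walk, and that of
the total jump length. -/
theorem collisionTime_sub_eq (S : ℕ → ℤ) (ζ : ℤ → Set.Ioi (0 : ℝ)) (n : ℕ) (m J : ℝ) :
    collisionTime S (envOfGaps ζ) n - n * (m * J) =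
      ∑ j ∈ crossedEdges S n, (crossings S n j : ℝ) * ((ζ j : ℝ) - m) +
        m * (∑ k ∈ Finset.range n, |((S (k + 1) - S k : ℤ) : ℝ)| - n * J) := by
  rw [← collisionTime_sub_eq_sum]; ring

theorem integrable_collisionTime_sub
    (hν : Integrable (fun z : Set.Ioi (0 : ℝ) => (z : ℝ)) ν) (S : ℕ → ℤ) (n : ℕ) (J : ℝ) :
    Integrable (fun ζ => collisionTime S (envOfGaps ζ) n - n * (meanGap ν * J)) (gapLaw ν) := by
  simp_rw [collisionTime_sub_eq]
  exact (integrable_weighted_gaps hν (crossedEdges S n) (fun j => (crossings S n j : ℝ))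
    (meanGap ν)).add (integrable_const _)

theorem integral_abs_collisionTime_sub_le
    (hν : Integrable (fun z : Set.Ioi (0 : ℝ) => (z : ℝ)) ν) {ε C : ℝ}
    (hw : ∀ (s : Finset ℤ) (w : ℤ → ℝ), (∀ i, 0 ≤ w i) →
      ∫ ζ : ℤ → Set.Ioi (0 : ℝ), |∑ i ∈ s, w i * ((ζ i : ℝ) - meanGap ν)| ∂gapLaw ν ≤
      ε * ∑ i ∈ s, w i + C * √(∑ i ∈ s, w i ^ 2)) (S : ℕ → ℤ) (n : ℕ) (J : ℝ) :
    ∫ ζ, |collisionTime S (envOfGaps ζ) n - n * (meanGap ν * J)| ∂gapLaw ν ≤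
      ε * ∑ k ∈ Finset.range n, |((S (k + 1) - S k : ℤ) : ℝ)| +
      C * √(∑ k ∈ Finset.range n, ∑ l ∈ Finset.range n,
        ((jumpEdges S k ∩ jumpEdges S l).card : ℝ)) +
      meanGap ν * |∑ k ∈ Finset.range n, |((S (k + 1) - S k : ℤ) : ℝ)| - n * J| := by
  have hm : 0 < meanGap ν := meanGap_pos hν
  have hi := integrable_weighted_gaps hν (crossedEdges S n) (fun j => (crossings S n j : ℝ))
    (meanGap ν)
  have h2 := hw (crossedEdges S n) (fun j => (crossings S n j : ℝ)) fun j => Nat.cast_nonneg _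
  rw [sum_crossings, sum_sq_crossings] at h2
  have h1 : ∫ ζ, |collisionTime S (envOfGaps ζ) n - n * (meanGap ν * J)| ∂gapLaw ν ≤
      ∫ ζ : ℤ → Set.Ioi (0 : ℝ),
        (|∑ j ∈ crossedEdges S n, (crossings S n j : ℝ) * ((ζ j : ℝ) - meanGap ν)| +
        meanGap ν * |∑ k ∈ Finset.range n, |((S (k + 1) - S k : ℤ) : ℝ)| - n * J|) ∂gapLaw ν := by
    refine integral_mono (integrable_collisionTime_sub hν S n J).abs
      (hi.abs.add (integrable_const _)) fun ζ => ?_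
    simp only [collisionTime_sub_eq]
    refine (abs_add_le _ _).trans_eq ?_
    rw [abs_mul, abs_of_pos hm]
  rw [integral_add hi.abs (integrable_const _), integral_const, probReal_univ, one_smul] at h1
  linarith

/-- The law of large numbers for the collision times. -/
theorem tendsto_measure_collisionTime (hν : Integrable (fun z : Set.Ioi (0 : ℝ) => (z : ℝ)) ν)
    (hsymm : ∀ k : ℤ, p (-k) = p k)
    (hv : Summable fun k : ℤ => (k : ℝ) ^ 2 * (p k).toReal)
    (hv_pos : 0 < ∑' k : ℤ, (k : ℝ) ^ 2 * (p k).toReal) {η : ℝ} (hη : 0 < η) :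
    Tendsto (fun n : ℕ => ((stepLaw p).prod (gapLaw ν)).real {x | η * n ≤
      |collisionTime (walkOfIncrements x.1) (envOfGaps x.2) n -
        n * (meanGap ν * meanAbsJump p)|}) atTop (𝓝 0) := by
  set m := meanGap ν
  set J := meanAbsJump p
  have hJ : 0 < J := meanAbsJump_pos hv hv_pos
  have hm : 0 < m := meanGap_pos hν
  set f : ℤ → ℝ := fun k => |(k : ℝ)|
  have hfm : Measurable f := measurable_from_top
  have hf2 : MemLp f 2 p.toMeasure := (memLp_step hv).abs
  have hfJ : ∫ k, f k ∂p.toMeasure = J := integral_abs_step hv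
  have key : ∀ ε : ℝ, 0 < ε → ∀ᶠ n : ℕ in atTop, ((stepLaw p).prod (gapLaw ν)).real {x | η * n ≤
      |collisionTime (walkOfIncrements x.1) (envOfGaps x.2) n - n * (m * J)|} ≤ ε := by
    intro ε hε
    -- Four error terms will each have mean at most `δ n`, and Markov's inequality divides by `η n`.
    set δ := ε * η / 4
    have hδ : 0 < δ := by positivity
    obtain ⟨C, hC, hw⟩ := exists_integral_abs_weighted_le (ι := ℤ) (κ := ν)
      (f := fun z : Set.Ioi (0 : ℝ) => (z : ℝ)) measurable_subtype_coe hν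
      (show 0 < δ / J by positivity)
    have hsq : Tendsto (fun n : ℕ => m * √Var[f; p.toMeasure] * (√(n : ℝ))⁻¹) atTop (𝓝 0) := by
      rw [← mul_zero (m * √Var[f; p.toMeasure])]
      exact (tendsto_inv_atTop_zero.comp (Real.tendsto_sqrt_atTop.comp
        tendsto_natCast_atTop_atTop)).const_mul _
    -- The tolerance is matched to the coefficient of `V` in `b` below. Using `C + 1` avoids
    -- dividing by zero when `C = 0`.
    filter_upwards [eventually_integral_sum_card_inter_le hsymm hv hv_pos
      (ε := 4 * δ ^ 2 / (C + 1) ^ 2) (by positivity), hsq.eventually_lt_const hδ,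
      eventually_gt_atTop 0] with n hV hn2 hn0
    have hn : (0 : ℝ) < n := by exact_mod_cast hn0
    set V : (ℕ → ℤ) → ℝ := fun ξ => ∑ k ∈ Finset.range n, ∑ l ∈ Finset.range n,
      ((jumpEdges (walkOfIncrements ξ) k ∩ jumpEdges (walkOfIncrements ξ) l).card : ℝ)
    have hVi : Integrable V (stepLaw p) := integrable_finsetSum _ fun k _ =>
      integrable_finsetSum _ fun l _ => integrable_card_inter hv k l
    have hVE : ∫ ξ, V ξ ∂stepLaw p ≤ 4 * δ ^ 2 / (C + 1) ^ 2 * (n : ℝ) ^ 2 := by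
      rw [integral_finsetSum _ fun k _ =>
        integrable_finsetSum _ fun l _ => integrable_card_inter hv k l]
      simp_rw [integral_finsetSum _ fun l _ => integrable_card_inter hv _ l]
      exact hV
    set L : (ℕ → ℤ) → ℝ := fun ξ => ∑ k ∈ Finset.range n, f (ξ k)
    have hfi : ∀ k : ℕ, Integrable (fun ξ : ℕ → ℤ => f (ξ k)) (stepLaw p) := fun k =>
      (memLp_eval hf2 k).integrable (by norm_num)
    have hLi : Integrable L (stepLaw p) := integrable_finsetSum _ fun k _ => hfi k
    have hLE : ∫ ξ, L ξ ∂stepLaw p = n * J := by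
      rw [integral_finsetSum _ fun k _ => hfi k]
      simp_rw [(identDistrib_eval hfm _).integral_eq, hfJ]
      simp
    set D : (ℕ → ℤ) → ℝ := fun ξ => |L ξ - n * J|
    have hDi : Integrable D (stepLaw p) := (hLi.sub (integrable_const _)).abs
    have hDE : ∫ ξ, D ξ ∂stepLaw p ≤ √(n * Var[f; p.toMeasure]) := by
      have h := integral_abs_weighted_le hfm hf2 (Finset.range n) fun _ => 1
      simp only [one_mul, Finset.sum_sub_distrib, Finset.sum_const, Finset.card_range,
        nsmul_eq_mul, hfJ, one_pow, mul_one] at h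
      exact h
    -- The conditional bound contains `(C + 1) √V`; it is replaced by its arithmetic-geometric
    -- majorant, linear in `V`, so that the mean of `V` suffices.
    set b : (ℕ → ℤ) → ℝ := fun ξ =>
      (δ / J * L ξ + (δ * n + (C + 1) ^ 2 / (4 * δ * n) * V ξ)) + m * D ξ
    have i1 : Integrable (fun ξ => δ / J * L ξ) (stepLaw p) := hLi.const_mul _
    have i2 : Integrable (fun ξ => δ * n + (C + 1) ^ 2 / (4 * δ * n) * V ξ) (stepLaw p) :=
      (integrable_const _).add (hVi.const_mul _)
    have i3 : Integrable (fun ξ => m * D ξ) (stepLaw p) := hDi.const_mul _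
    have hbi : Integrable b (stepLaw p) := (i1.add i2).add i3
    have hbE : ∫ ξ, b ξ ∂stepLaw p ≤ 4 * δ * n := by
      have hb : ∫ ξ, b ξ ∂stepLaw p = ∫ ξ, δ / J * L ξ ∂stepLaw p +
          (∫ _, δ * n ∂stepLaw p + ∫ ξ, (C + 1) ^ 2 / (4 * δ * n) * V ξ ∂stepLaw p) +
          ∫ ξ, m * D ξ ∂stepLaw p :=
        (integral_add (i1.add i2) i3).trans (congrArg (· + _) ((integral_add i1 i2).trans
          (congrArg (_ + ·) (integral_add (integrable_const _) (hVi.const_mul _)))))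
      rw [hb, integral_const, probReal_univ, one_smul, integral_const_mul, integral_const_mul,
        integral_const_mul, hLE]
      have h1 : δ / J * (n * J) = δ * n := by field_simp
      have h2 : (C + 1) ^ 2 / (4 * δ * n) * ∫ ξ, V ξ ∂stepLaw p ≤ δ * n := by
        refine (mul_le_mul_of_nonneg_left hVE (by positivity)).trans_eq ?_
        field_simp
      have h3 : m * ∫ ξ, D ξ ∂stepLaw p ≤ δ * n := by
        refine (mul_le_mul_of_nonneg_left hDE hm.le).trans ?_
        rw [Real.sqrt_mul hn.le]
        have h4 := mul_le_mul_of_nonneg_right hn2.le hn.le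
        have h5 : (√(n : ℝ))⁻¹ * n = √(n : ℝ) := by
          rw [inv_mul_eq_div, Real.div_sqrt]
        calc m * (√(n : ℝ) * √Var[f; p.toMeasure])
            = m * √Var[f; p.toMeasure] * ((√(n : ℝ))⁻¹ * n) := by rw [h5]; ring
          _ ≤ δ * n := by linarith
      linarith
    have hF : Measurable fun x : (ℕ → ℤ) × (ℤ → Set.Ioi (0 : ℝ)) =>
        collisionTime (walkOfIncrements x.1) (envOfGaps x.2) n - n * (m * J) :=
      ((measurable_collisionTime n).comp measurable_walk_env).sub_const _
    refine (prod_real_le_of_integral_abs_le hF hbi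
      (fun ξ => integrable_collisionTime_sub hν (walkOfIncrements ξ) n _)
      (fun ξ => ?_) (by positivity)).trans (?_ : _ / (η * n) ≤ ε)
    · refine (integral_abs_collisionTime_sub_le hν hw (walkOfIncrements ξ) n J).trans ?_
      have hLw : ∑ k ∈ Finset.range n,
          |((walkOfIncrements ξ (k + 1) - walkOfIncrements ξ k : ℤ) : ℝ)| = L ξ :=
        Finset.sum_congr rfl fun k _ => by rw [walk_succ_sub]
      have hV0 : 0 ≤ V ξ := Finset.sum_nonneg fun k _ => Finset.sum_nonneg fun l _ =>
        Nat.cast_nonneg _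
      have h3 : (C + 1) * √(V ξ) ≤ δ * n + (C + 1) ^ 2 / (4 * δ * n) * V ξ := by
        have h4 : δ * n + (C + 1) ^ 2 / (4 * δ * n) * V ξ - (C + 1) * √(V ξ) =
            (2 * δ * n - (C + 1) * √(V ξ)) ^ 2 / (4 * δ * n) := by
          obtain ⟨y, hy, hy2⟩ : ∃ y, y = √(V ξ) ∧ V ξ = y ^ 2 := ⟨_, rfl, (Real.sq_sqrt hV0).symm⟩
          rw [← hy, hy2]
          field_simp; ring
        have : 0 ≤ (2 * δ * n - (C + 1) * √(V ξ)) ^ 2 / (4 * δ * n) := by positivity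
        linarith
      have h5 : C * √(V ξ) ≤ (C + 1) * √(V ξ) :=
        mul_le_mul_of_nonneg_right (by linarith) (Real.sqrt_nonneg _)
      rw [hLw]
      change δ / J * L ξ + C * √(V ξ) + m * D ξ ≤
        (δ / J * L ξ + (δ * n + (C + 1) ^ 2 / (4 * δ * n) * V ξ)) + m * D ξ
      linarith
    · rw [div_le_iff₀ (by positivity)]
      have : 4 * δ = ε * η := by simp only [δ]; ring
      calc _ ≤ 4 * δ * n := hbE
        _ = ε * (η * n) := by rw [this]; ring
  rw [Metric.tendsto_nhds]
  intro ε hε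
  filter_upwards [key (ε / 2) (by positivity)] with n hn
  rw [Real.dist_eq, sub_zero, abs_of_nonneg measureReal_nonneg]
  linarith

/-- If all collision times stay below `K`, then for `n ≥ 2K / c` the deviation from `n c` is at
least `n c / 2`, an event whose probability tends to zero. -/
theorem ae_collisionTime_unbounded (hν : Integrable (fun z : Set.Ioi (0 : ℝ) => (z : ℝ)) ν)
    (hsymm : ∀ k : ℤ, p (-k) = p k)
    (hv : Summable fun k : ℤ => (k : ℝ) ^ 2 * (p k).toReal)
    (hv_pos : 0 < ∑' k : ℤ, (k : ℝ) ^ 2 * (p k).toReal) :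
    ∀ᵐ x ∂(stepLaw p).prod (gapLaw ν), ∀ t : ℝ, ∃ n,
      t < collisionTime (walkOfIncrements x.1) (envOfGaps x.2) n := by
  set c := meanGap ν * meanAbsJump p
  have hc : 0 < c := mul_pos (meanGap_pos hν) (meanAbsJump_pos hv hv_pos)
  have h : ∀ K : ℕ, ∀ᵐ x ∂(stepLaw p).prod (gapLaw ν), ∃ n,
      (K : ℝ) < collisionTime (walkOfIncrements x.1) (envOfGaps x.2) n := by
    intro K
    rw [ae_iff, ← measureReal_eq_zero_iff]
    refine le_antisymm (ge_of_tendsto (tendsto_measure_collisionTime hν hsymm hv hv_pos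
      (half_pos hc)) ?_) measureReal_nonneg
    filter_upwards [eventually_ge_atTop ⌈2 * K / c⌉₊] with n hn
    refine measureReal_mono fun x hx => ?_
    simp only [Set.mem_ofPred_eq, not_exists, not_lt] at hx ⊢
    have h1 := Nat.ceil_le.1 hn
    rw [div_le_iff₀ hc] at h1
    rw [abs_sub_comm]
    refine le_trans ?_ (le_abs_self _)
    linarith [hx n]
  filter_upwards [ae_all_iff.2 h] with x hx t
  obtain ⟨K, hK⟩ := exists_nat_gt t
  obtain ⟨n, hn⟩ := hx K
  exact ⟨n, hK.trans hn⟩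

end Joint

/-! ### Localisation of the path near `μ S_N` -/

section Path

/-- A point of the path lies between two consecutive targets, hence close to any site that the
walk visits around that time. -/
theorem abs_path_sub_le {S : ℕ → ℤ} {ω : Env} {t : ℝ≥0} {a b N : ℕ} {c : ℤ} {d m : ℝ}
    (hub : ∀ t : ℝ, ∃ n, t < collisionTime S ω n) (ha : collisionTime S ω a ≤ t)
    (hb : (t : ℝ) < collisionTime S ω b) (haN : a ≤ N) (hNb : N ≤ b)
    (hS : ∀ k, a ≤ k → k ≤ b → |S k - S a| ≤ c)
    (hup : ω (S N + 2 * c) - m * (S N + 2 * c : ℤ) ≤ d)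
    (hlo : -d ≤ ω (S N + -(2 * c)) - m * (S N + -(2 * c) : ℤ)) :
    |path S ω t - m * S N| ≤ 2 * m * c + d := by
  obtain ⟨n, h1, h2⟩ := exists_index t.2 (hub t)
  have hpath : path S ω t = ω (S n) +
      ((S (n + 1) - S n).sign : ℝ) * (t - collisionTime S ω n) := by
    rw [path, dif_pos hub]
    exact position_eq h1 h2
  -- The jump under way at time `t` starts and ends at indices in `[a, b]`, so its two ends obey the
  -- bound `hS`.
  have han : a ≤ n := by
    by_contra h
    linarith [collisionTime_mono S ω (show n + 1 ≤ a by omega),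
      show (t : ℝ) < collisionTime S ω (n + 1) from h2]
  have hnb : n + 1 ≤ b := by
    by_contra h
    linarith [collisionTime_mono S ω (show b ≤ n by omega),
      show collisionTime S ω n ≤ (t : ℝ) from h1]
  -- All three sites are within `c` of `S a`, hence within `2c` of one another.
  have e1 := abs_le.1 (hS n han (by omega))
  have e2 := abs_le.1 (hS (n + 1) (by omega) hnb)
  have e3 := abs_le.1 (hS N haN hNb)
  have hmono := ω.2.2.monotone
  have u1 : ω (S n) ≤ ω (S N + 2 * c) := hmono (by omega)
  have u2 : ω (S (n + 1)) ≤ ω (S N + 2 * c) := hmono (by omega)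
  have l1 : ω (S N + -(2 * c)) ≤ ω (S n) := hmono (by omega)
  have l2 : ω (S N + -(2 * c)) ≤ ω (S (n + 1)) := hmono (by omega)
  have hbetween : ω (S N + -(2 * c)) ≤ path S ω t ∧ path S ω t ≤ ω (S N + 2 * c) := by
    have hsucc := target_succ_eq S ω n
    have h1' : 0 ≤ (t : ℝ) - collisionTime S ω n := sub_nonneg.2 h1
    have h2' : (t : ℝ) - collisionTime S ω n ≤
        collisionTime S ω (n + 1) - collisionTime S ω n :=
      sub_le_sub_right (le_of_lt h2) _
    rw [hpath]
    rcases lt_trichotomy (S (n + 1) - S n) 0 with h | h | h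
    · rw [Int.sign_eq_neg_one_of_neg h] at hsucc ⊢
      push_cast at hsucc ⊢
      constructor <;> linarith
    · rw [h] at hsucc ⊢
      simp only [Int.sign_zero, Int.cast_zero, zero_mul, add_zero] at hsucc ⊢
      exact ⟨l1, u1⟩
    · rw [Int.sign_eq_one_of_pos h] at hsucc ⊢
      push_cast at hsucc ⊢
      constructor <;> linarith
  push_cast at hup hlo
  rw [abs_le]
  constructor <;> linarith [hbetween.1, hbetween.2]

variable {ν : Measure (Set.Ioi (0 : ℝ))} [IsProbabilityMeasure ν] {p : PMF ℤ}

theorem measureReal_prod_fst {A B : Type*} {mA : MeasurableSpace A} {mB : MeasurableSpace B}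
    {P : Measure A} {Q : Measure B} [IsProbabilityMeasure P] [IsProbabilityMeasure Q]
    (s : Set A) : (P.prod Q).real {x | x.1 ∈ s} = P.real s := by
  have h : {x : A × B | x.1 ∈ s} = s ×ˢ Set.univ := by ext; simp
  rw [h, measureReal_prod_prod, probReal_univ, mul_one]

/-- Kolmogorov's inequality for the walk restarted at time `a`, by shift invariance of the
increments. -/
theorem measure_exists_walk_sub_le (hsymm : ∀ k : ℤ, p (-k) = p k)
    (hv : Summable fun k : ℤ => (k : ℝ) ^ 2 * (p k).toReal) {a b : ℕ} (hab : a ≤ b) {r : ℝ}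
    (hr : 0 < r) :
    (stepLaw p).real {ξ | ∃ k, a ≤ k ∧ k ≤ b ∧
      r ≤ |(walkOfIncrements ξ k - walkOfIncrements ξ a : ℝ)|} ≤
      (b - a : ℝ) * (∑' k : ℤ, (k : ℝ) ^ 2 * (p k).toReal) / r ^ 2 := by
  have h := measure_exists_le_abs_sum (κ := p.toMeasure) (f := fun k : ℤ => (k : ℝ))
    measurable_from_top (memLp_step hv) (integral_step hsymm hv) (b - a) hr
  rw [variance_step hsymm hv, Nat.cast_sub hab] at h
  refine le_trans (le_of_eq ?_) h
  have hmeas : MeasurableSet {ξ : ℕ → ℤ | ∃ k ≤ b - a,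
      r ≤ |∑ i ∈ Finset.range k, ((ξ i : ℤ) : ℝ)|} := by
    have : {ξ : ℕ → ℤ | ∃ k ≤ b - a, r ≤ |∑ i ∈ Finset.range k, ((ξ i : ℤ) : ℝ)|} =
        ⋃ k ∈ Set.Iic (b - a), {ξ : ℕ → ℤ | r ≤ |(walkOfIncrements ξ k : ℝ)|} := by
      ext ξ; simp [cast_walk]
    rw [this]
    exact MeasurableSet.biUnion (Set.to_countable _) fun k _ =>
      measurableSet_le measurable_const (measurable_cast_walk k).abs
  rw [← (measurePreserving_shift (κ := p.toMeasure) a).measureReal_preimage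
    hmeas.nullMeasurableSet]
  congr 1
  ext ξ
  simp only [Set.mem_ofPred_eq, Set.mem_preimage, ← cast_walk]
  constructor
  · rintro ⟨k, hak, hkb, hk⟩
    refine ⟨k - a, by omega, ?_⟩
    have := walk_add ξ a (k - a)
    rw [Nat.add_sub_cancel' hak] at this
    rwa [this, Int.cast_add, add_sub_cancel_left] at hk
  · rintro ⟨k, hk, h⟩
    refine ⟨a + k, by omega, by omega, ?_⟩
    rwa [walk_add, Int.cast_add, add_sub_cancel_left]

/-- The path stays close to the rescaled walk at the deterministic time `t / (μ m)`. -/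
theorem tendsto_measure_path_sub (hν : Integrable (fun z : Set.Ioi (0 : ℝ) => (z : ℝ)) ν)
    (hsymm : ∀ k : ℤ, p (-k) = p k)
    (hv : Summable fun k : ℤ => (k : ℝ) ^ 2 * (p k).toReal)
    (hv_pos : 0 < ∑' k : ℤ, (k : ℝ) ^ 2 * (p k).toReal) {η : ℝ} (hη : 0 < η) :
    Tendsto (fun t : ℝ≥0 => ((stepLaw p).prod (gapLaw ν)).real {x | η * √(t : ℝ) ≤
      |path (walkOfIncrements x.1) (envOfGaps x.2) t - meanGap ν *
        walkOfIncrements x.1 ⌊(t : ℝ) / (meanGap ν * meanAbsJump p)⌋₊|}) atTop (𝓝 0) := by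
  set m := meanGap ν
  set J := meanAbsJump p
  set v := ∑' k : ℤ, (k : ℝ) ^ 2 * (p k).toReal with hvdef
  have hm : 0 < m := meanGap_pos hν
  have hJ : 0 < J := meanAbsJump_pos hv hv_pos
  set c₀ := m * J with hc₀
  have hc : 0 < c₀ := mul_pos hm hJ
  have key : ∀ ε' : ℝ, 0 < ε' → ∀ᶠ t : ℝ≥0 in atTop,
      ((stepLaw p).prod (gapLaw ν)).real {x | η * √(t : ℝ) ≤
      |path (walkOfIncrements x.1) (envOfGaps x.2) t - m *
        walkOfIncrements x.1 ⌊(t : ℝ) / c₀⌋₊|} ≤ 5 * ε' := by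
    intro ε' hε'
    -- The final error is at most `2mc + δ√t ≤ (2m + 1) δ√t`; the extra `δ` makes it strictly less
    -- than `η√t`.
    set δ := η / (2 * m + 2) with hδdef
    have hδ : 0 < δ := by positivity
    -- The window has about `2 ε t / c₀` steps, so `2 ε v / (c₀ δ²)` is the leading term in
    -- Kolmogorov's bound at level `δ√t`; the rounding of its ends adds a term of order `1 / t`.
    obtain ⟨ε, hε, hε1, hε2⟩ : ∃ ε : ℝ, 0 < ε ∧ ε ≤ 1 / 2 ∧
        2 * ε * v / (c₀ * δ ^ 2) ≤ ε' / 2 := by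
      refine ⟨min (1 / 2) (ε' * c₀ * δ ^ 2 / (4 * v)), by positivity, min_le_left _ _, ?_⟩
      have h : min (1 / 2) (ε' * c₀ * δ ^ 2 / (4 * v)) ≤ ε' * c₀ * δ ^ 2 / (4 * v) :=
        min_le_right _ _
      calc 2 * min (1 / 2) (ε' * c₀ * δ ^ 2 / (4 * v)) * v / (c₀ * δ ^ 2)
          ≤ 2 * (ε' * c₀ * δ ^ 2 / (4 * v)) * v / (c₀ * δ ^ 2) := by gcongr
        _ = ε' / 2 := by field_simp; norm_num
    set a : ℝ≥0 → ℕ := fun t => ⌊(1 - ε) * ((t : ℝ) / c₀)⌋₊ with hadef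
    set b : ℝ≥0 → ℕ := fun t => ⌈(1 + ε) * ((t : ℝ) / c₀)⌉₊ with hbdef
    set N : ℝ≥0 → ℕ := fun t => ⌊(t : ℝ) / c₀⌋₊ with hNdef
    have htR : Tendsto (fun t : ℝ≥0 => (t : ℝ)) atTop atTop := NNReal.tendsto_coe_atTop.2 tendsto_id
    have hta : Tendsto a atTop atTop := tendsto_nat_floor_atTop.comp
      ((htR.atTop_div_const hc).const_mul_atTop (by linarith))
    have htb : Tendsto b atTop atTop := tendsto_nat_ceil_atTop.comp
      ((htR.atTop_div_const hc).const_mul_atTop (by linarith))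
    have hcol := tendsto_measure_collisionTime hν hsymm hv hv_pos
      (η := ε * c₀ / 2) (by positivity)
    -- Chosen so that `√(N v) + 2c ≤ A √t`, the input of the law of large numbers at the sites `S_N
    -- ± 2c`.
    set A := √(v / c₀) + 2 * δ with hAdef
    have hA : 0 < A := by positivity
    obtain ⟨r₀, hr₀⟩ := exists_measure_target_walk_le hν hsymm hv hA hδ hε' (p := p)
    have hsqrt : Tendsto (fun t : ℝ≥0 => √(t : ℝ)) atTop atTop :=
      Real.tendsto_sqrt_atTop.comp htR
    have hG2 : Tendsto (fun t : ℝ≥0 => 2 * v / δ ^ 2 * (t : ℝ)⁻¹) atTop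
        (𝓝 (2 * v / δ ^ 2 * 0)) := (tendsto_inv_atTop_zero.comp htR).const_mul _
    rw [mul_zero] at hG2
    filter_upwards [(hcol.comp hta).eventually_lt_const hε',
      (hcol.comp htb).eventually_lt_const hε', hsqrt.eventually_ge_atTop r₀,
      hG2.eventually_lt_const (half_pos hε'), eventually_gt_atTop 0] with t h1 h2 h3 h4 h5
    have ht : (0 : ℝ) < t := h5
    have hst : 0 < √(t : ℝ) := Real.sqrt_pos.2 ht
    have hT : 0 < (t : ℝ) / c₀ := by positivity
    set c : ℤ := ⌊δ * √(t : ℝ)⌋ with hcdef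
    have hc0 : 0 ≤ c := Int.floor_nonneg.2 (by positivity)
    have hcle : (c : ℝ) ≤ δ * √(t : ℝ) := Int.floor_le _
    have hcR : (0 : ℝ) ≤ c := by exact_mod_cast hc0
    have haN : a t ≤ N t := Nat.floor_mono (by nlinarith)
    have hNb : N t ≤ b t := (Nat.floor_mono (show (t : ℝ) / c₀ ≤ (1 + ε) * (t / c₀) by nlinarith)).trans
      (Nat.floor_le_ceil _)
    have ha1 : (a t : ℝ) ≤ (1 - ε) * (t / c₀) := Nat.floor_le (by nlinarith)
    have ha2 : (1 - ε) * (t / c₀) < a t + 1 := Nat.lt_floor_add_one _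
    have hb1 : (1 + ε) * (t / c₀) ≤ b t := Nat.le_ceil _
    have hb2 : (b t : ℝ) < (1 + ε) * (t / c₀) + 1 := Nat.ceil_lt_add_one (by positivity)
    have htc : (t : ℝ) / c₀ * c₀ = t := by field_simp
    have hNv : √(N t * v) + |((2 * c : ℤ) : ℝ)| ≤ A * √(t : ℝ) := by
      have hN : (N t : ℝ) ≤ t / c₀ := Nat.floor_le hT.le
      have e1 : √(N t * v) ≤ √(v / c₀) * √(t : ℝ) := by
        rw [← Real.sqrt_mul (by positivity)]
        refine Real.sqrt_le_sqrt ?_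
        calc N t * v ≤ t / c₀ * v := by gcongr
          _ = v / c₀ * t := by ring
      have e2 : |((2 * c : ℤ) : ℝ)| = 2 * c := by
        push_cast; rw [abs_of_nonneg (by positivity)]
      rw [e2, hAdef]; nlinarith
    have h6 := hr₀ _ h3 (N t) (2 * c) hNv
    have h7 := hr₀ _ h3 (N t) (-(2 * c)) (by push_cast at hNv ⊢; rwa [abs_neg])
    have h8 := measure_exists_walk_sub_le hsymm hv (haN.trans hNb)
      (show 0 < δ * √(t : ℝ) by positivity)
    have h8' : (b t - a t : ℝ) * v / (δ * √(t : ℝ)) ^ 2 ≤ ε' := by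
      rw [mul_pow, Real.sq_sqrt ht.le]
      have e1 : (b t - a t : ℝ) ≤ 2 * ε * (t / c₀) + 2 := by linarith
      calc (b t - a t : ℝ) * v / (δ ^ 2 * t) ≤ (2 * ε * (t / c₀) + 2) * v / (δ ^ 2 * t) := by
            gcongr
        _ = 2 * ε * v / (c₀ * δ ^ 2) + 2 * v / δ ^ 2 * (t : ℝ)⁻¹ := by field_simp
        _ ≤ ε' := by linarith
    rw [← measureReal_prod_fst (Q := gapLaw ν)] at h8
    set P := (stepLaw p).prod (gapLaw ν)
    -- The five bad events: collision time off at `a`, off at `b`, walk too mobile in the window,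
    -- environment off at `S_N + 2c`, off at `S_N - 2c`.
    set E1 : Set ((ℕ → ℤ) × (ℤ → Set.Ioi (0 : ℝ))) := {x | ε * c₀ / 2 * (a t : ℝ) ≤
      |collisionTime (walkOfIncrements x.1) (envOfGaps x.2) (a t) - (a t : ℝ) * c₀|}
    set E2 : Set ((ℕ → ℤ) × (ℤ → Set.Ioi (0 : ℝ))) := {x | ε * c₀ / 2 * (b t : ℝ) ≤
      |collisionTime (walkOfIncrements x.1) (envOfGaps x.2) (b t) - (b t : ℝ) * c₀|}
    set E3 : Set ((ℕ → ℤ) × (ℤ → Set.Ioi (0 : ℝ))) := {x | x.1 ∈ {ξ | ∃ k, a t ≤ k ∧ k ≤ b t ∧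
      δ * √(t : ℝ) ≤ |(walkOfIncrements ξ k - walkOfIncrements ξ (a t) : ℝ)|}}
    set E4 : Set ((ℕ → ℤ) × (ℤ → Set.Ioi (0 : ℝ))) := {x | δ * √(t : ℝ) ≤
      |target x.2 (walkOfIncrements x.1 (N t) + 2 * c) -
        m * (walkOfIncrements x.1 (N t) + 2 * c : ℤ)|}
    set E5 : Set ((ℕ → ℤ) × (ℤ → Set.Ioi (0 : ℝ))) := {x | δ * √(t : ℝ) ≤
      |target x.2 (walkOfIncrements x.1 (N t) + -(2 * c)) -
        m * (walkOfIncrements x.1 (N t) + -(2 * c) : ℤ)|}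
    replace h1 : P.real E1 < ε' := h1
    replace h2 : P.real E2 < ε' := h2
    have hE : ∀ᵐ x ∂P, η * √(t : ℝ) ≤ |path (walkOfIncrements x.1) (envOfGaps x.2) t - m *
        walkOfIncrements x.1 (N t)| → x ∈ E1 ∪ (E2 ∪ (E3 ∪ (E4 ∪ E5))) := by
      filter_upwards [ae_collisionTime_unbounded hν hsymm hv hv_pos] with x hub hx
      by_contra hnot
      simp only [Set.mem_union, not_or] at hnot
      obtain ⟨n1, n2, n3, n4, n5⟩ := hnot
      simp only [E1, Set.mem_ofPred_eq, not_le] at n1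
      simp only [E2, Set.mem_ofPred_eq, not_le] at n2
      simp only [E3, Set.mem_ofPred_eq, not_exists, not_and, not_le] at n3
      simp only [E4, Set.mem_ofPred_eq, not_le] at n4
      simp only [E5, Set.mem_ofPred_eq, not_le] at n5
      have k1 : collisionTime (walkOfIncrements x.1) (envOfGaps x.2) (a t) ≤ t := by
        have := (abs_lt.1 n1).2
        have e1 : (a t : ℝ) * c₀ ≤ (1 - ε) * t :=
          calc (a t : ℝ) * c₀ ≤ (1 - ε) * (t / c₀) * c₀ := by gcongr
            _ = (1 - ε) * t := by rw [mul_assoc, htc]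
        have e2 := mul_le_mul_of_nonneg_left e1 (show 0 ≤ 1 + ε / 2 by linarith)
        -- The relative error `ε / 2` allowed for the collision time is smaller than the margin `ε`
        -- of the window; likewise at `b`, where `ε < 1` is used.
        have e3 : (1 + ε / 2) * ((1 - ε) * t) ≤ t := by
          have : 0 ≤ (ε / 2 + ε ^ 2 / 2) * t := by positivity
          linarith
        linarith
      have k2 : (t : ℝ) < collisionTime (walkOfIncrements x.1) (envOfGaps x.2) (b t) := by
        have := (abs_lt.1 n2).1
        have e1 : (1 + ε) * t ≤ (b t : ℝ) * c₀ :=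
          calc (1 + ε) * t = (1 + ε) * (t / c₀) * c₀ := by rw [mul_assoc, htc]
            _ ≤ (b t : ℝ) * c₀ := by gcongr
        have e2 := mul_le_mul_of_nonneg_left e1 (show 0 ≤ 1 - ε / 2 by linarith)
        have e3 : t ≤ (1 - ε / 2) * ((1 + ε) * t) := by
          have : 0 ≤ ε / 2 * (1 - ε) * t :=
            mul_nonneg (mul_nonneg (by linarith) (by linarith)) ht.le
          linarith
        linarith
      have k3 : ∀ k, a t ≤ k → k ≤ b t →
          |walkOfIncrements x.1 k - walkOfIncrements x.1 (a t)| ≤ c := fun k hk1 hk2 => by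
        -- Displacements are integers, so nothing is lost in passing from `δ√t` to its floor `c`.
        refine Int.le_floor.2 ?_
        push_cast
        exact (n3 k hk1 hk2).le
      have h := abs_path_sub_le (m := m) hub k1 k2 haN hNb k3 (abs_lt.1 n4).2.le
        (abs_lt.1 n5).1.le
      have e1 : 2 * m * c ≤ 2 * m * (δ * √(t : ℝ)) := by gcongr
      have e2 : (2 * m + 2) * (δ * √(t : ℝ)) = η * √(t : ℝ) := by
        rw [hδdef]; field_simp
      have e3 : 0 < δ * √(t : ℝ) := by positivity
      linarith
    have hle : P.real {x | η * √(t : ℝ) ≤ |path (walkOfIncrements x.1) (envOfGaps x.2) t - m *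
        walkOfIncrements x.1 (N t)|} ≤ P.real (E1 ∪ (E2 ∪ (E3 ∪ (E4 ∪ E5)))) :=
      ENNReal.toReal_mono (measure_ne_top _ _) (measure_mono_ae hE)
    have u1 := measureReal_union_le (μ := P) E1 (E2 ∪ (E3 ∪ (E4 ∪ E5)))
    have u2 := measureReal_union_le (μ := P) E2 (E3 ∪ (E4 ∪ E5))
    have u3 := measureReal_union_le (μ := P) E3 (E4 ∪ E5)
    have u4 := measureReal_union_le (μ := P) E4 E5
    have h8'' : P.real E3 ≤ ε' := h8.trans h8'
    have h6' : P.real E4 ≤ ε' := h6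
    have h7' : P.real E5 ≤ ε' := h7
    linarith
  rw [Metric.tendsto_nhds]
  intro ε hε
  filter_upwards [key (ε / 10) (by positivity)] with n hn
  rw [Real.dist_eq, sub_zero, abs_of_nonneg measureReal_nonneg]
  linarith

end Path

/-! ### The annealed central limit theorem -/

section Annealed

variable {ν : Measure (Set.Ioi (0 : ℝ))} [IsProbabilityMeasure ν] {p : PMF ℤ}

/-- Transfers the problem to independent increments and gaps. The annealed law integrates over the
environment last, hence the symmetric form of Fubini. -/
theorem map_annealedLaw_eval (t : ℝ≥0) :
    (annealedLaw ν p).map (fun z : PathSpace × Env => z.1 t / √(t : ℝ)) =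
      ((stepLaw p).prod (gapLaw ν)).map fun x =>
        path (walkOfIncrements x.1) (envOfGaps x.2) t / √(t : ℝ) := by
  have hev : Measurable fun f : PathSpace => f t / √(t : ℝ) :=
    (continuous_eval_const t).measurable.div_const _
  have hpath : Measurable fun x : (ℕ → ℤ) × Env => path x.1 x.2 t / √(t : ℝ) :=
    hev.comp measurable_path
  have hR : ((stepLaw p).prod (gapLaw ν)).map (fun x =>
        path (walkOfIncrements x.1) (envOfGaps x.2) t / √(t : ℝ)) =
      ((walkLaw p).prod (envLaw ν)).map fun x => path x.1 x.2 t / √(t : ℝ) := by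
    rw [walkLaw, envLaw, Measure.map_prod_map _ _ measurable_walkOfIncrements
      measurable_envOfGaps, Measure.map_map hpath
      (measurable_walkOfIncrements.prodMap measurable_envOfGaps)]
    rfl
  have hfst : Measurable fun z : PathSpace × Env => z.1 t / √(t : ℝ) := hev.comp measurable_fst
  rw [hR, annealedLaw, Measure.map_map hfst measurable_swap]
  ext s hs
  have hs' : MeasurableSet ((fun f : PathSpace => f t / √(t : ℝ)) ⁻¹' s) := hev hs
  rw [Measure.map_apply (hfst.comp measurable_swap) hs,
    Measure.map_apply hpath hs, Measure.prod_apply_symm (hpath hs),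
    Measure.compProd_apply ((hfst.comp measurable_swap) hs)]
  refine lintegral_congr fun ω => ?_
  exact Measure.map_apply (measurable_path.comp (measurable_id.prodMk measurable_const)) hs'

theorem measurable_path_eval (t : ℝ≥0) :
    Measurable fun x : (ℕ → ℤ) × (ℤ → Set.Ioi (0 : ℝ)) =>
      path (walkOfIncrements x.1) (envOfGaps x.2) t := by
  have h : Measurable fun x : (ℕ → ℤ) × Env => path x.1 x.2 t :=
    (continuous_eval_const (F := PathSpace) t).measurable.comp measurable_path
  have h2 := h.comp measurable_walk_env
  simpa only [Function.comp_def] using h2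

theorem tendstoInDistribution_walk_prod (hsymm : ∀ k : ℤ, p (-k) = p k)
    (hv : Summable fun k : ℤ => (k : ℝ) ^ 2 * (p k).toReal) {ι : Type*} {l : Filter ι}
    {N : ι → ℕ} (hN : Tendsto N l atTop) :
    TendstoInDistribution
      (fun i (x : (ℕ → ℤ) × (ℤ → Set.Ioi (0 : ℝ))) =>
        (√(N i : ℝ))⁻¹ * (walkOfIncrements x.1 (N i) : ℝ)) l
      (id : ℝ → ℝ) (fun _ => (stepLaw p).prod (gapLaw ν))
      (gaussianReal 0 (∑' k : ℤ, (k : ℝ) ^ 2 * (p k).toReal).toNNReal) where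
  forall_aemeasurable i :=
    (((measurable_cast_walk (N i)).comp measurable_fst).const_mul _).aemeasurable
  tendsto := by
    refine ((tendstoInDistribution_walk hsymm hv).tendsto.comp hN).congr fun i => ?_
    refine Subtype.ext ?_
    have h := (measurePreserving_fst (μ := stepLaw p) (ν := gapLaw ν)).map_eq
    change (stepLaw p).map _ = ((stepLaw p).prod (gapLaw ν)).map _
    conv_lhs => rw [← h]
    rw [Measure.map_map ((measurable_cast_walk (N i)).const_mul _) measurable_fst]
    rfl

/-- Up to `o(1)` in probability, `X(t) / √t` is `S_N / √N` times the deterministic factor `μ √N /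
√t`. The latter tends to `μ / √(μ J)` because `⌊x⌋ / x → 1`, and Slutsky's theorem applies. -/
theorem tendstoInDistribution_path (hν : Integrable (fun z : Set.Ioi (0 : ℝ) => (z : ℝ)) ν)
    (hsymm : ∀ k : ℤ, p (-k) = p k)
    (hv : Summable fun k : ℤ => (k : ℝ) ^ 2 * (p k).toReal)
    (hv_pos : 0 < ∑' k : ℤ, (k : ℝ) ^ 2 * (p k).toReal) :
    TendstoInDistribution
      (fun (t : ℝ≥0) (x : (ℕ → ℤ) × (ℤ → Set.Ioi (0 : ℝ))) =>
        path (walkOfIncrements x.1) (envOfGaps x.2) t / √(t : ℝ)) atTop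
      (fun y : ℝ => y * (meanGap ν / √(meanGap ν * meanAbsJump p)))
      (fun _ => (stepLaw p).prod (gapLaw ν))
      (gaussianReal 0 (∑' k : ℤ, (k : ℝ) ^ 2 * (p k).toReal).toNNReal) := by
  set c := meanGap ν * meanAbsJump p
  have hc : 0 < c := mul_pos (meanGap_pos hν) (meanAbsJump_pos hv hv_pos)
  have htR : Tendsto (fun t : ℝ≥0 => (t : ℝ)) atTop atTop := NNReal.tendsto_coe_atTop.2 tendsto_id
  have htc : Tendsto (fun t : ℝ≥0 => (t : ℝ) / c) atTop atTop := htR.atTop_div_const hc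
  have hN : Tendsto (fun t : ℝ≥0 => ⌊(t : ℝ) / c⌋₊) atTop atTop := tendsto_nat_floor_atTop.comp htc
  have hconst : Tendsto (fun t : ℝ≥0 => meanGap ν * √(⌊(t : ℝ) / c⌋₊ : ℝ) / √(t : ℝ)) atTop
      (𝓝 (meanGap ν / √c)) := by
    have h := ((tendsto_nat_floor_div_atTop (R := ℝ)).comp htc).sqrt.const_mul (meanGap ν / √c)
    rw [Real.sqrt_one, mul_one] at h
    refine h.congr' ?_
    filter_upwards [eventually_gt_atTop 0] with t ht
    have ht' : (0 : ℝ) < t := ht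
    have hct : √c ≠ 0 := (Real.sqrt_pos.2 hc).ne'
    simp only [Function.comp_apply]
    rw [Real.sqrt_div (Nat.cast_nonneg _), Real.sqrt_div ht'.le]
    field_simp
  have hmeas : TendstoInMeasure ((stepLaw p).prod (gapLaw ν))
      (fun (t : ℝ≥0) _ => meanGap ν * √(⌊(t : ℝ) / c⌋₊ : ℝ) / √(t : ℝ)) atTop
      fun _ => meanGap ν / √c := by
    rw [tendstoInMeasure_iff_norm]
    intro ε hε
    refine tendsto_const_nhds.congr' ?_
    filter_upwards [Metric.tendsto_nhds.1 hconst ε hε] with t ht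
    rw [dist_eq_norm] at ht
    have he : {_x : (ℕ → ℤ) × (ℤ → Set.Ioi (0 : ℝ)) |
        ε ≤ ‖meanGap ν * √(⌊(t : ℝ) / c⌋₊ : ℝ) / √(t : ℝ) - meanGap ν / √c‖} = ∅ :=
      Set.eq_empty_of_forall_notMem fun x hx => not_le.2 ht hx
    rw [he, measure_empty]
  have h1 := (tendstoInDistribution_walk_prod (ν := ν) hsymm hv hN)
    |>.continuous_comp_prodMk_of_tendstoInMeasure_const (g := fun q : ℝ × ℝ => q.1 * q.2)
    (Y := fun (t : ℝ≥0) _ => meanGap ν * √(⌊(t : ℝ) / c⌋₊ : ℝ) / √(t : ℝ))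
    (c := meanGap ν / √c) (by fun_prop) hmeas (by fun_prop)
  refine tendstoInDistribution_of_tendstoInMeasure_sub _ _ h1 ?_ fun t =>
    ((measurable_path_eval t).div_const _).aemeasurable
  rw [tendstoInMeasure_iff_measureReal_norm]
  intro η hη
  refine (tendsto_measure_path_sub hν hsymm hv hv_pos hη).congr' ?_
  -- The factor `√N` cancels its inverse only when `N ≠ 0`.
  have hN0 : ∀ᶠ t : ℝ≥0 in atTop, ⌊(t : ℝ) / c⌋₊ ≠ 0 := hN.eventually_ne_atTop 0
  filter_upwards [eventually_gt_atTop 0, hN0] with t ht htN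
  have ht' : 0 < √(t : ℝ) := Real.sqrt_pos.2 ht
  have hN' : √(⌊(t : ℝ) / c⌋₊ : ℝ) ≠ 0 := (Real.sqrt_pos.2 (by positivity)).ne'
  congr 1
  ext x
  have e : path (walkOfIncrements x.1) (envOfGaps x.2) t / √(t : ℝ) -
      (√(⌊(t : ℝ) / c⌋₊ : ℝ))⁻¹ * (walkOfIncrements x.1 ⌊(t : ℝ) / c⌋₊ : ℝ) *
        (meanGap ν * √(⌊(t : ℝ) / c⌋₊ : ℝ) / √(t : ℝ)) =
      (path (walkOfIncrements x.1) (envOfGaps x.2) t -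
        meanGap ν * walkOfIncrements x.1 ⌊(t : ℝ) / c⌋₊) / √(t : ℝ) := by
    field_simp
  simp only [Set.mem_ofPred_eq, Pi.sub_apply, Pi.zero_apply, sub_zero, Real.norm_eq_abs]
  rw [e, abs_div, abs_of_pos ht', le_div_iff₀ ht']

end Annealed

end LevyWalk

theorem mainTheorem3
    (ν : MeasureTheory.Measure (Set.Ioi (0 : ℝ))) [IsProbabilityMeasure ν]
    (hν : Integrable (fun z : Set.Ioi (0 : ℝ) => (z : ℝ)) ν)
    (p : PMF ℤ)
    (hsymm : ∀ k : ℤ, p (-k) = p k)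
    (hmono : ∀ k : ℤ, 0 ≤ k → p (k + 1) ≤ p k)
    (hv : Summable fun k : ℤ => (k : ℝ) ^ 2 * (p k).toReal)
    (hv_pos : 0 < ∑' k : ℤ, (k : ℝ) ^ 2 * (p k).toReal) :
    Tendsto (LevyWalk.normalizedMoment p 2) atTop (𝓝 (LevyWalk.rescaledMoment p 2)) ∧
    TendstoInDistribution
      (fun (t : ℝ≥0) (z : LevyWalk.PathSpace × LevyWalk.Env) => z.1 t / √(t : ℝ))
      atTop (id : ℝ → ℝ) (fun _ => LevyWalk.annealedLaw ν p)
      (gaussianReal 0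
        (LevyWalk.meanGap ν / LevyWalk.meanAbsJump p * LevyWalk.rescaledMoment p 2).toNNReal) := by
  rw [LevyWalk.rescaledMoment_two hsymm hv]
  refine ⟨LevyWalk.tendsto_normalizedMoment_two hsymm hv, ?_⟩
  have hm := LevyWalk.meanGap_pos hν
  have hJ := LevyWalk.meanAbsJump_pos hv hv_pos
  have hev : ∀ t : ℝ≥0, Measurable fun z : LevyWalk.PathSpace × LevyWalk.Env =>
      z.1 t / √(t : ℝ) := fun t =>
    ((continuous_eval_const t).measurable.comp measurable_fst).div_const _
  refine ⟨fun t => (hev t).aemeasurable, aemeasurable_id, ?_⟩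
  -- Scaling by `μ / √(μ J)` multiplies the variance by `μ² / (μ J) = μ / J`.
  have hlim : (gaussianReal 0 (LevyWalk.meanGap ν / LevyWalk.meanAbsJump p *
      ∑' k : ℤ, (k : ℝ) ^ 2 * (p k).toReal).toNNReal).map id =
      (gaussianReal 0 (∑' k : ℤ, (k : ℝ) ^ 2 * (p k).toReal).toNNReal).map fun y =>
        y * (LevyWalk.meanGap ν / √(LevyWalk.meanGap ν * LevyWalk.meanAbsJump p)) := by
    rw [Measure.map_id, gaussianReal_map_mul_const, mul_zero]
    congr 1
    ext
    push_cast
    rw [Real.coe_toNNReal _ (by positivity), Real.coe_toNNReal _ hv_pos.le, div_pow,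
      Real.sq_sqrt (by positivity)]
    field_simp
  have h := (LevyWalk.tendstoInDistribution_path hν hsymm hv hv_pos).tendsto
  simp only [← LevyWalk.map_annealedLaw_eval, ← hlim] at h
  exact h
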